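/- **Setting.** Let $Q=[0,1)^3$, $Q'=[-\pi,\pi)^3$, $e_\kappa(x)=e^{i\kappa\cdot x}$, and let $C^\infty_\#(Q)$ denote the smooth $Q$-periodic (scalar or vector) functions. Let $\mu$ be a $Q$-periodic Borel measure on $\mathbb R^3$ with $\mu(Q)=1$ and $\int_Q\partial_j\varphi\,d\mu=0$ for all $\varphi\in C^\infty_\#(Q)$, $j=1,2,3$. Let $A,\widetilde A$ (the inverses of the electric permittivity and of the magnetic permeability) be real, measurable, $Q$-periodic, symmetric, bounded and uniformly positive definite $3\times3$ matrix functions. *Spaces.* For $\kappa\in\mathbb R^3$, $H^1_{\mathrm{curl}A^{1/2},\kappa}(Q,d\mu)$ is the closure in $L^2(Q,d\mu)\oplus L^2(Q,d\mu)$ of the set of pairs $(e_\kappa\varphi,\operatorname{curl}(e_\kappa A^{1/2}\varphi))$ with $A^{1/2}\varphi\in C^\infty_\#(Q)$; its elements are written in the same way, and the index $\kappa$ is omitted for $\kappa=0$. $H^1_{\#,0}(Q,d\mu)$ consists of the pairs $(\psi,\nabla\psi)$ with $\int_Q\psi\,d\mu=0$ in the closure of $\{(\varphi,\nabla\varphi):\varphi\in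 C^\infty_\#(Q)\}$; for them $\nabla(e_\kappa\psi):=e_\kappa(\nabla\psi+i\kappa\psi)$. $C^\infty_{\#,0}(Q)$ is the set of $\varphi\in C_\#^\infty(Q)$ with $\int_Q\varphi\,d\mu=0$. *Cell problems.* For $c\in\mathbb C^3$ let $\psi_{\kappa,c}\in H^1_{\#,0}(Q,d\mu)$ solve $$\int_Q A^{-1}\nabla(e_\kappa\psi_{\kappa,c})\cdot\overline{\nabla(e_\kappa\varphi)}\,d\mu=-\int_QA^{-1}e_\kappa c\cdot\overline{\nabla(e_\kappa\varphi)}\,d\mu\qquad\forall\varphi\in C^\infty_{\#,0}(Q),$$ and write $\psi_{\kappa,c}=\Psi_\kappa\cdot c$. Let the matrix $\widetilde N\in H^1_{\mathrm{curl}A^{1/2}}(Q,d\mu)$ (understood column by column) solve $$\int_Q\widetilde A\,(\operatorname{curl}(A^{1/2}\widetilde N)+I)\cdot\overline{\operatorname{curl}(A^{1/2}\varphi)}\,d\mu=0\qquad\forall\,(\varphi,\operatorname{curl}(A^{1/2}\varphi))\in H^1_{\mathrm{curl}A^{1/2}}(Q,d\mu),\ \int_QA^{1/2}\varphi\,d\mu=0,$$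 with $\operatorname{div}(A^{-1/2}\widetilde N)=0$ weakly (that is, tested with $\nabla\varphi$, $\varphi\in C^\infty_\#(Q)$) and $\int_QA^{1/2}\widetilde N\,d\mu=0$. Let $N=\widetilde N+A^{-1/2}(\nabla\Psi+a)$, where $a\in\mathbb C^{3\times3}$ is an arbitrary constant matrix (which may depend on all parameters, e.g. on $\theta$) with columns $a_j$, and $\nabla\Psi$ has the columns $\nabla\psi_{0,a_j}$. "$\operatorname{curl}N$" stands for $\operatorname{curl}(A^{1/2}N)$. Put $$\widetilde A^{\rm hom}=\int_Q\widetilde A(\operatorname{curl}(A^{1/2}\widetilde N)+I)\,d\mu,\qquad \widehat A^{\rm hom}_\kappa=\int_QA^{-1}\bigl(\overline{e_\kappa}\nabla(e_\kappa\Psi_\kappa)+I\bigr)\,d\mu .$$ *Maxwell problem.* For $\varepsilon>0$, $\theta\in\varepsilon^{-1}Q'$, $\kappa=\varepsilon\theta$, let $G\in L^2(Q,d\mu)$ satisfy $\int_Qe_\kappa G\cdot\overline{\nabla(e_\kappa\varphi)}\,d\mu=0$ for all $\varphi\in C^\infty_\#(Q)$, and let $D^\varepsilon_\theta$, with $(e_\kappa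 D^\varepsilon_\theta,\operatorname{curl}(e_\kappa A^{1/2}D^\varepsilon_\theta))\in H^1_{\mathrm{curl}A^{1/2},\kappa}(Q,d\mu)$, solve $$\varepsilon^{-2}\int_Q\widetilde A\operatorname{curl}(e_\kappa A^{1/2}D^\varepsilon_\theta)\cdot\overline{\operatorname{curl}(e_\kappa A^{1/2}\varphi)}\,d\mu+\int_QD^\varepsilon_\theta\cdot\overline\varphi\,d\mu=-\int_QA^{1/2}G\cdot\overline\varphi\,d\mu$$ for all $(e_\kappa\varphi,\operatorname{curl}(e_\kappa A^{1/2}\varphi))\in H^1_{\mathrm{curl}A^{1/2},\kappa}(Q,d\mu)$. The transformed magnetic induction and magnetic field are $B^\varepsilon_\theta=-\varepsilon^{-1}\overline{e_\kappa}\operatorname{curl}(e_\kappa A^{1/2}D^\varepsilon_\theta)$ and $H^\varepsilon_\theta=\widetilde AB^\varepsilon_\theta$. Finally let $$d^\varepsilon_\theta=-\bigl(\widehat A^{\rm hom}_{\varepsilon\theta}\bigr)^{-1}\Bigl(i\theta\times\widetilde A^{\rm hom}\,i\theta\times\bigl(\widehat A^{\rm hom}_{\varepsilon\theta}\bigr)^{-1}+I\Bigr)^{-1}\int_QG\,d\mu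 .$$ **Theorem.** There is a constant $C>0$, depending only on $\mu$, $A$, $\widetilde A$ (in particular independent of $\theta$, $\varepsilon$ and $G$), such that for all $\varepsilon>0$, $\theta\in\varepsilon^{-1}Q'$ and all $G$ as above $$\bigl\|B^\varepsilon_\theta+(\operatorname{curl}N+I)(i\theta\times d^\varepsilon_\theta)\bigr\|_{L^2(Q,d\mu)}\le C\varepsilon\|G\|_{L^2(Q,d\mu)},$$ $$\bigl\|H^\varepsilon_\theta+\widetilde A(\operatorname{curl}N+I)(i\theta\times d^\varepsilon_\theta)\bigr\|_{L^2(Q,d\mu)}\le C\varepsilon\|G\|_{L^2(Q,d\mu)}.$$ -/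

import Mathlib

open MeasureTheory
open scoped ContDiff

namespace PeriodicMaxwell

noncomputable section

/-! ### Vectors, matrices, classical differential operators -/

/-- Physical space `ℝ³`. -/
abbrev R3 := EuclideanSpace ℝ (Fin 3)

/-- Complex vectors `ℂ³` with the Euclidean norm. -/
abbrev C3 := EuclideanSpace ℂ (Fin 3)

/-- Real `3 × 3` matrices. -/
abbrev M3 := Matrix (Fin 3) (Fin 3) ℝ

/-- A real matrix acting on a complex vector. -/
def act (M : M3) (v : C3) : C3 :=
  WithLp.toLp 2 ((M.map (fun t : ℝ => (t : ℂ))).mulVec v.ofLp)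

/-- The bilinear dot product `u · v = ∑ uᵢ vᵢ` (no conjugation). -/
def dot (u v : C3) : ℂ := ∑ i, u i * v i

/-- Componentwise complex conjugation. -/
def conjVec (v : C3) : C3 := WithLp.toLp 2 (fun i => (starRingEnd ℂ) (v i))

/-- The matrix of the map `v ↦ a × v`. -/
def crossMatrix (a : Fin 3 → ℂ) : Matrix (Fin 3) (Fin 3) ℂ :=
  !![0, -a 2, a 1; a 2, 0, -a 0; -a 1, a 0, 0]

theorem crossMatrix_mulVec (a v : Fin 3 → ℂ) :
    (crossMatrix a).mulVec v = crossProduct a v := by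
  funext i
  fin_cases i <;>
    simp [crossMatrix, cross_apply, Matrix.mulVec, dotProduct, Fin.sum_univ_three] <;> ring

/-- The vector `iθ`. -/
def iVec (θ : R3) : C3 := WithLp.toLp 2 (fun j => Complex.I * (θ j : ℂ))

/-- The classical partial derivative `∂ⱼ f`. -/
def partialDeriv (j : Fin 3) (f : R3 → ℂ) (x : R3) : ℂ :=
  fderiv ℝ f x (EuclideanSpace.single j 1)

/-- The classical gradient. -/
def gradient (f : R3 → ℂ) (x : R3) : C3 := WithLp.toLp 2 (fun j => partialDeriv j f x)

/-- The classical curl. -/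
def curl (f : R3 → C3) (x : R3) : C3 :=
  !₂[partialDeriv 1 (fun y => f y 2) x - partialDeriv 2 (fun y => f y 1) x,
     partialDeriv 2 (fun y => f y 0) x - partialDeriv 0 (fun y => f y 2) x,
     partialDeriv 0 (fun y => f y 1) x - partialDeriv 1 (fun y => f y 0) x]

/-- `Q`-periodicity, for the unit cell `Q = [0,1)³`. -/
def IsPeriodic {X : Type*} (f : R3 → X) : Prop :=
  ∀ (j : Fin 3) (x : R3), f (x + EuclideanSpace.single j 1) = f x

/-- The exponential `e_κ(x) = exp(i κ · x)`. -/
def expo (κ : R3) (x : R3) : ℂ := Complex.exp (Complex.I * ((∑ j, κ j * x j : ℝ) : ℂ))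

/-! ### The measure and the coefficients -/

/-- The unit cell `Q = [0,1)³`. -/
def cell : Set R3 := {x | ∀ j, x j ∈ Set.Ico (0 : ℝ) 1}

/-- The measure `μ` on the unit cell. -/
def onCell (μ : Measure R3) : Measure R3 := μ.restrict cell

/-- A `Q`-periodic Borel measure with `μ(Q) = 1` such that partial derivatives of smooth periodic
functions have zero mean over `Q`. -/
structure IsAdmissibleMeasure (μ : Measure R3) : Prop where
  periodic : ∀ (j : Fin 3) (B : Set R3), MeasurableSet B →
    μ ((fun x => x + EuclideanSpace.single j 1) ⁻¹' B) = μ B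
  cell_mass : μ cell = 1
  deriv_mean_zero : ∀ φ : R3 → ℂ, ContDiff ℝ ∞ φ → IsPeriodic φ →
    ∀ j : Fin 3, ∫ x, partialDeriv j φ x ∂(onCell μ) = 0

/-- A real, measurable, `Q`-periodic, symmetric, bounded and uniformly positive definite
matrix-valued coefficient. -/
structure IsCoefficient (A : R3 → M3) : Prop where
  measurable : ∀ i j, Measurable fun x => A x i j
  periodic : IsPeriodic A
  symm : ∀ x, (A x).IsSymm
  elliptic : ∃ α β : ℝ, 0 < α ∧ ∀ (x : R3) (v : Fin 3 → ℝ),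
    α * dotProduct v v ≤ dotProduct v ((A x).mulVec v) ∧
      dotProduct v ((A x).mulVec v) ≤ β * dotProduct v v

open scoped MatrixOrder in
/-- The positive semidefinite square root of a positive semidefinite matrix. -/
def sqrtM (M : M3) : M3 := CFC.sqrt M

open scoped MatrixOrder in
theorem sqrtM_mul_self {M : M3} (h : M.PosSemidef) : sqrtM M * sqrtM M = M :=
  CFC.sqrt_mul_sqrt_self M h.nonneg

open scoped MatrixOrder in
theorem sqrtM_posSemidef (M : M3) : (sqrtM M).PosSemidef :=
  Matrix.nonneg_iff_posSemidef.mp (CFC.sqrt_nonneg M)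

/-! ### Sobolev spaces with respect to `μ` -/

/-- `(u, v)` belongs to `H¹_{curl A^{1/2}, κ}(Q, dμ)`: it is in the `L² ⊕ L²` closure of the set of
pairs `(e_κ φ, curl (e_κ A^{1/2} φ))` with `A^{1/2} φ` smooth and periodic. For `κ = 0` this is
`H¹_{curl A^{1/2}}(Q, dμ)`. -/
def MemHCurl (μ : Measure R3) (A : R3 → M3) (κ : R3) (u v : R3 → C3) : Prop :=
  MemLp u 2 (onCell μ) ∧ MemLp v 2 (onCell μ) ∧
    ∀ δ : ENNReal, 0 < δ → ∃ φ : R3 → C3,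
      ContDiff ℝ ∞ (fun x => act (sqrtM (A x)) (φ x)) ∧
      IsPeriodic (fun x => act (sqrtM (A x)) (φ x)) ∧
      eLpNorm (fun x => u x - expo κ x • φ x) 2 (onCell μ) < δ ∧
      eLpNorm (fun x => v x - curl (fun y => expo κ y • act (sqrtM (A y)) (φ y)) x) 2
        (onCell μ) < δ

/-- `(ψ, g)` belongs to `H¹_{#,0}(Q, dμ)`: `ψ` has zero mean and `(ψ, g)` is in the `L² ⊕ L²`
closure of the pairs `(φ, ∇φ)` with `φ` smooth and periodic. -/
def MemH1Zero (μ : Measure R3) (ψ : R3 → ℂ) (g : R3 → C3) : Prop :=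
  MemLp ψ 2 (onCell μ) ∧ MemLp g 2 (onCell μ) ∧
    (∀ δ : ENNReal, 0 < δ → ∃ φ : R3 → ℂ, ContDiff ℝ ∞ φ ∧ IsPeriodic φ ∧
      eLpNorm (fun x => ψ x - φ x) 2 (onCell μ) < δ ∧
      eLpNorm (fun x => g x - gradient φ x) 2 (onCell μ) < δ) ∧
    ∫ x, ψ x ∂(onCell μ) = 0

/-- `∇(e_κ ψ) = e_κ (∇ψ + iκ ψ)` for `(ψ, g) ∈ H¹_{#,0}`, with `g` the gradient of `ψ`. -/
def quasiGrad (κ : R3) (ψ : R3 → ℂ) (g : R3 → C3) (x : R3) : C3 :=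
  expo κ x • (g x + ψ x • iVec κ)

/-- `e̅_κ div (e_κ G) = 0` in the weak sense. -/
def IsQuasiDivFree (μ : Measure R3) (κ : R3) (G : R3 → C3) : Prop :=
  ∀ φ : R3 → ℂ, ContDiff ℝ ∞ φ → IsPeriodic φ →
    ∫ x, dot (expo κ x • G x) (conjVec (gradient (fun y => expo κ y * φ y) x)) ∂(onCell μ) = 0

/-! ### Cell problems -/

/-- `(ψ, g) ∈ H¹_{#,0}` is the weak solution `ψ_c` of
`e̅_κ div A⁻¹ (∇(e_κ ψ_c) + e_κ c) = 0`. -/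
def IsGradCellSol (μ : Measure R3) (A : R3 → M3) (κ : R3) (c : C3)
    (ψ : R3 → ℂ) (g : R3 → C3) : Prop :=
  MemH1Zero μ ψ g ∧
    ∀ φ : R3 → ℂ, ContDiff ℝ ∞ φ → IsPeriodic φ → ∫ x, φ x ∂(onCell μ) = 0 →
      ∫ x, dot (act (A x)⁻¹ (quasiGrad κ ψ g x))
          (conjVec (gradient (fun y => expo κ y * φ y) x)) ∂(onCell μ) =
        -∫ x, dot (act (A x)⁻¹ (expo κ x • c))
          (conjVec (gradient (fun y => expo κ y * φ y) x)) ∂(onCell μ)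

/-- The `j`-th standard basis vector of `ℂ³`. -/
def basisVec (j : Fin 3) : C3 := EuclideanSpace.single j 1

/-- `Ψ_κ`, a vector function with components `Ψ j` and their gradients `g j`. -/
def IsPsi (μ : Measure R3) (A : R3 → M3) (κ : R3) (Ψ : Fin 3 → R3 → ℂ)
    (g : Fin 3 → R3 → C3) : Prop :=
  ∀ j, IsGradCellSol μ A κ (basisVec j) (Ψ j) (g j)

/-- The matrix `Âʰᵒᵐ_κ = ∫_Q A⁻¹ (e̅_κ ∇(e_κ Ψ_κ) + I)`. -/
def hatAHom (μ : Measure R3) (A : R3 → M3) (κ : R3) (Ψ : Fin 3 → R3 → ℂ)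
    (g : Fin 3 → R3 → C3) : Matrix (Fin 3) (Fin 3) ℂ :=
  Matrix.of fun i j => (∫ x, act (A x)⁻¹
    ((starRingEnd ℂ) (expo κ x) • quasiGrad κ (Ψ j) (g j) x + basisVec j) ∂(onCell μ)) i

/-- The matrix `Ñ` with columns `N j`, and the columns `W j` of `curl (A^{1/2} Ñ)`, solve the cell
problem `A^{1/2} curl Ã (curl A^{1/2} Ñ + I) = 0`, `div A^{-1/2} Ñ = 0`, `∫_Q A^{1/2} Ñ = 0`. -/
structure IsCurlCellSol (μ : Measure R3) (A At : R3 → M3) (N W : Fin 3 → R3 → C3) : Prop where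
  mem : ∀ j, MemHCurl μ A 0 (N j) (W j)
  weak : ∀ (j : Fin 3) (φ w : R3 → C3), MemHCurl μ A 0 φ w →
    ∫ x, act (sqrtM (A x)) (φ x) ∂(onCell μ) = 0 →
    ∫ x, dot (act (At x) (W j x)) (conjVec (w x)) ∂(onCell μ) =
      -∫ x, dot (act (At x) (basisVec j)) (conjVec (w x)) ∂(onCell μ)
  div_free : ∀ (j : Fin 3) (φ : R3 → ℂ), ContDiff ℝ ∞ φ → IsPeriodic φ →
    ∫ x, dot (act (sqrtM (A x))⁻¹ (N j x)) (conjVec (gradient φ x)) ∂(onCell μ) = 0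
  mean_zero : ∀ j, ∫ x, act (sqrtM (A x)) (N j x) ∂(onCell μ) = 0

/-- The matrix `Ãʰᵒᵐ = ∫_Q Ã (curl A^{1/2} Ñ + I)`, given the columns `W j` of `curl A^{1/2} Ñ`. -/
def tildeAHom (μ : Measure R3) (At : R3 → M3) (W : Fin 3 → R3 → C3) :
    Matrix (Fin 3) (Fin 3) ℂ :=
  Matrix.of fun i j => (∫ x, act (At x) (W j x + basisVec j) ∂(onCell μ)) i

/-- The matrix `N = Ñ + A^{-1/2} (∇Ψ + a)` (columns `N j`), with columns `W j` of
`curl (A^{1/2} N)`. Here `a` is some constant matrix with columns `a j`, and the vector function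
`Ψ` (components `Ψ j`, gradients `g j`) satisfies `div A⁻¹ (∇Ψ + a) = 0`. -/
def IsCorrector (μ : Measure R3) (A : R3 → M3) (Ntilde N W : Fin 3 → R3 → C3) : Prop :=
  ∃ (a : Fin 3 → C3) (Ψ : Fin 3 → R3 → ℂ) (g : Fin 3 → R3 → C3), ∀ j,
    IsGradCellSol μ A 0 (a j) (Ψ j) (g j) ∧ MemHCurl μ A 0 (N j) (W j) ∧
    ∀ᵐ x ∂(onCell μ), N j x = Ntilde j x + act (sqrtM (A x))⁻¹ (g j x + a j)

/-! ### The Maxwell problem and its approximation -/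

/-- `D`, with `V = curl (e_κ A^{1/2} D)` and `κ = ε θ`, is the weak solution of
`ε⁻² A^{1/2} e̅_κ curl Ã curl (e_κ A^{1/2} D) + D = -A^{1/2} G`. -/
def IsMaxwellSol (μ : Measure R3) (A At : R3 → M3) (ε : ℝ) (θ : R3) (G D V : R3 → C3) : Prop :=
  MemHCurl μ A (ε • θ) (fun x => expo (ε • θ) x • D x) V ∧
    ∀ φ w : R3 → C3, MemHCurl μ A (ε • θ) (fun x => expo (ε • θ) x • φ x) w →
      ((ε ^ 2)⁻¹ : ℝ) * ∫ x, dot (act (At x) (V x)) (conjVec (w x)) ∂(onCell μ) +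
          ∫ x, dot (D x) (conjVec (φ x)) ∂(onCell μ) =
        -∫ x, dot (act (sqrtM (A x)) (G x)) (conjVec (φ x)) ∂(onCell μ)

/-- The transformed magnetic induction, determined by the first line
`ε⁻¹ e̅_κ curl (e_κ A^{1/2} D) + B = 0` of the transformed Maxwell system. -/
def magInduction (ε : ℝ) (θ : R3) (V : R3 → C3) (x : R3) : C3 :=
  -(((ε⁻¹ : ℝ) : ℂ) • ((starRingEnd ℂ) (expo (ε • θ) x) • V x))

/-- The vector `d = -Â⁻¹ (iθ × Ãʰᵒᵐ iθ × Â⁻¹ + I)⁻¹ m`. -/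
def dVec (Ahat Atil : Matrix (Fin 3) (Fin 3) ℂ) (θ : R3) (m : C3) : C3 :=
  WithLp.toLp 2 (-(Ahat⁻¹ * (crossMatrix (iVec θ) * Atil * crossMatrix (iVec θ) * Ahat⁻¹ + 1)⁻¹).mulVec
    m.ofLp)

/-- The vector `iθ × d`. -/
def iCross (θ : R3) (d : C3) : C3 :=
  WithLp.toLp 2 (crossProduct (iVec θ).ofLp d.ofLp)

/-- `(curl A^{1/2} N + I) s`, given the columns `W j` of `curl A^{1/2} N`. -/
def curlPlusId (W : Fin 3 → R3 → C3) (s : C3) (x : R3) : C3 := (∑ j, s j • W j x) + s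

end

end PeriodicMaxwell

namespace PeriodicMaxwell

noncomputable section

/-! ### Vector algebra -/

/-! The condition on derivatives makes every nonzero Fourier coefficient of `μ` vanish, so the
exponentials with frequencies `2πk` are orthonormal in `L²(Q, dμ)`. They are complete by
Stone–Weierstrass, and `fourierEquiv` identifies the vector-valued `L²` with square-summable
sequences in `ℂ³`. On the sequence side the κ-twisted curl is `v ↦ iξ × v`, the twisted gradient is
a multiple of `iξ`, and `ξ = 2πk + κ`. Since `κ ∈ Q'`, one has `|ξ| ≥ 1` for `k ≠ 0`; this gap does
the work of Poincaré and Helmholtz estimates uniform in `κ`.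

Let `S`, `T` be multiplication by `A⁻¹`, `Ã`, let `F = A^{1/2} D`, and let `X = -B` be the scaled
twisted curl of `F`. The Maxwell problem says that the scaled twisted curl of `T X`, plus `S F`,
equals `-G`. Put `s = iθ × d`. The expected approximations are `y = w + s` for `X`, with `w =
curl(A^{1/2} Ñ) s`, and `z = z₀ + d` for `F`, with `z₀` the twisted gradient of `Ψ_κ · d`. Choose a
vector potential `n` of `w`, put `q = iκ × n`, and set `R = F - z - εn`. Its scaled twisted curl is
`v = X - y - q`, and testing the equation with `R` gives `⟨v, Tv⟩ + ⟨R, SR⟩ = -(⟨v, Ty⟩ + ⟨R, Sz +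
G⟩) - ⟨v, Tq⟩ - ε⟨R, Sn⟩`.

The bracket is small. At `k = 0` it vanishes, because `d` solves the homogenised equation
(`dVec_spec`). At `k ≠ 0`, `v` is orthogonal to `ξ` while `iξ × Ty` reduces to `iκ × Ty`; likewise
`Sz + G` is orthogonal to `ξ` while `iξ × R = εv`. Pairing a field orthogonal to `ξ` with another
field costs only the cross product of the latter with `ξ` (`norm_mul_norm_inner_le`), so each
pairing gains a factor `ε`. Coercivity then bounds `v`, and adding `q` bounds `X - y`
(`core_estimate`).

Uniformity in the unbounded parameter `θ` rests on `dispersion_estimates`: not only `d` and `s` but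
also `|θ| |s|` is bounded by the mean of `G`, which controls every term carrying `κ = εθ`. The
gradient and constant parts of `N` have no curl (`IsCorrector.curl_ae_eq`), and the bound for `H`
follows on multiplying by `Ã`. -/

/-- The bilinear product `ξ · v` of a real and a complex vector. -/
def realDot (ξ : R3) (v : C3) : ℂ := ∑ j, (ξ j : ℂ) * v j

theorem iCross_apply_zero (ξ : R3) (v : C3) :
    iCross ξ v 0 = Complex.I * (ξ 1 * v 2 - ξ 2 * v 1) := by
  simp [iCross, iVec, cross_apply]; ring

theorem iCross_apply_one (ξ : R3) (v : C3) :
    iCross ξ v 1 = Complex.I * (ξ 2 * v 0 - ξ 0 * v 2) := by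
  simp [iCross, iVec, cross_apply]; ring

theorem iCross_apply_two (ξ : R3) (v : C3) :
    iCross ξ v 2 = Complex.I * (ξ 0 * v 1 - ξ 1 * v 0) := by
  simp [iCross, iVec, cross_apply]; ring

theorem ext_C3 {u v : C3} (h0 : u 0 = v 0) (h1 : u 1 = v 1) (h2 : u 2 = v 2) : u = v := by
  ext i; fin_cases i <;> assumption

theorem iCross_add (ξ : R3) (u v : C3) : iCross ξ (u + v) = iCross ξ u + iCross ξ v := by
  apply ext_C3 <;> simp [iCross_apply_zero, iCross_apply_one, iCross_apply_two] <;> ring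

theorem iCross_smul (ξ : R3) (a : ℂ) (v : C3) : iCross ξ (a • v) = a • iCross ξ v := by
  apply ext_C3 <;> simp [iCross_apply_zero, iCross_apply_one, iCross_apply_two] <;> ring

/-- The linear map `v ↦ iξ × v`. -/
def iCrossLin (ξ : R3) : C3 →ₗ[ℂ] C3 where
  toFun := iCross ξ
  map_add' := iCross_add ξ
  map_smul' := iCross_smul ξ

@[simp] theorem iCrossLin_apply (ξ : R3) (v : C3) : iCrossLin ξ v = iCross ξ v := rfl

theorem iCross_zero (ξ : R3) : iCross ξ 0 = 0 := (iCrossLin ξ).map_zero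

theorem iCross_sub (ξ : R3) (u v : C3) : iCross ξ (u - v) = iCross ξ u - iCross ξ v :=
  (iCrossLin ξ).map_sub u v

theorem iCross_add_left (ξ η : R3) (v : C3) : iCross (ξ + η) v = iCross ξ v + iCross η v := by
  apply ext_C3 <;> simp [iCross_apply_zero, iCross_apply_one, iCross_apply_two] <;> ring

theorem iCross_smul_left (a : ℝ) (ξ : R3) (v : C3) : iCross (a • ξ) v = (a : ℂ) • iCross ξ v := by
  apply ext_C3 <;> simp [iCross_apply_zero, iCross_apply_one, iCross_apply_two] <;> ring

theorem inner_C3 (u v : C3) : inner ℂ u v =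
    v 0 * (starRingEnd ℂ) (u 0) + v 1 * (starRingEnd ℂ) (u 1) + v 2 * (starRingEnd ℂ) (u 2) := by
  simp [PiLp.inner_apply, Fin.sum_univ_three]

/-- Multiplying the real skew matrix of `ξ ×` by `i` makes it Hermitian. This is the symmetry of the
curl, frequency by frequency. -/
theorem inner_iCross_left (ξ : R3) (u v : C3) :
    inner ℂ (iCross ξ u) v = inner ℂ u (iCross ξ v) := by
  simp only [inner_C3, iCross_apply_zero, iCross_apply_one, iCross_apply_two, map_mul, map_sub,
    Complex.conj_I, Complex.conj_ofReal]
  ring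

theorem normSq_R3 (ξ : R3) : ‖ξ‖ ^ 2 = ξ 0 ^ 2 + ξ 1 ^ 2 + ξ 2 ^ 2 := by
  simp [EuclideanSpace.norm_sq_eq, Fin.sum_univ_three]

theorem realDot_iCross (ξ : R3) (v : C3) : realDot ξ (iCross ξ v) = 0 := by
  simp only [realDot, Fin.sum_univ_three, iCross_apply_zero, iCross_apply_one, iCross_apply_two]
  ring

theorem realDot_add (ξ : R3) (u v : C3) : realDot ξ (u + v) = realDot ξ u + realDot ξ v := by
  simp only [realDot, Fin.sum_univ_three, PiLp.add_apply]
  ring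

theorem realDot_sum_smul (ξ : R3) (s : C3) (v : Fin 3 → C3) (h : ∀ j, realDot ξ (v j) = 0) :
    realDot ξ (∑ j, s j • v j) = 0 := by
  have h' := fun j => h j
  simp only [realDot, Fin.sum_univ_three, PiLp.add_apply, PiLp.smul_apply, smul_eq_mul] at h' ⊢
  linear_combination s 0 * h' 0 + s 1 * h' 1 + s 2 * h' 2

/-- The double product formula leaves only the `|ξ|²` term, with sign `+` because `i² = -1`. Hence
the curl can be inverted on fields orthogonal to `ξ`. -/
theorem iCross_iCross_of_realDot_eq_zero {ξ : R3} {v : C3} (h : realDot ξ v = 0) :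
    iCross ξ (iCross ξ v) = ((‖ξ‖ ^ 2 : ℝ) : ℂ) • v := by
  simp only [realDot, Fin.sum_univ_three] at h
  rw [normSq_R3]
  apply ext_C3 <;>
    simp only [iCross_apply_zero, iCross_apply_one, iCross_apply_two, PiLp.smul_apply, smul_eq_mul,
      Complex.ofReal_add, Complex.ofReal_pow]
  · linear_combination (-ξ 0 : ℂ) * h + (ξ 1 * (ξ 0 * v 1 - ξ 1 * v 0) -
      ξ 2 * (ξ 2 * v 0 - ξ 0 * v 2) : ℂ) * Complex.I_sq
  · linear_combination (-ξ 1 : ℂ) * h + (ξ 2 * (ξ 1 * v 2 - ξ 2 * v 1) -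
      ξ 0 * (ξ 0 * v 1 - ξ 1 * v 0) : ℂ) * Complex.I_sq
  · linear_combination (-ξ 2 : ℂ) * h + (ξ 0 * (ξ 2 * v 0 - ξ 0 * v 2) -
      ξ 1 * (ξ 1 * v 2 - ξ 2 * v 1) : ℂ) * Complex.I_sq

/-- Lagrange's identity, applied separately to the real and imaginary parts of `v`. -/
theorem norm_iCross_le (ξ : R3) (v : C3) : ‖iCross ξ v‖ ≤ ‖ξ‖ * ‖v‖ := by
  have key : ∀ a b c x y z : ℝ, (b * z - c * y) ^ 2 + (c * x - a * z) ^ 2 + (a * y - b * x) ^ 2 ≤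
      (a ^ 2 + b ^ 2 + c ^ 2) * (x ^ 2 + y ^ 2 + z ^ 2) := by
    intro a b c x y z
    nlinarith [sq_nonneg (a * x + b * y + c * z)]
  refine le_of_sq_le_sq ?_ (by positivity)
  rw [mul_pow, normSq_R3, EuclideanSpace.norm_sq_eq, EuclideanSpace.norm_sq_eq,
    Fin.sum_univ_three, Fin.sum_univ_three, iCross_apply_zero, iCross_apply_one, iCross_apply_two]
  simp only [norm_mul, Complex.norm_I, one_mul, ← Complex.normSq_eq_norm_sq, Complex.normSq_apply,
    Complex.sub_re, Complex.sub_im, Complex.re_ofReal_mul, Complex.im_ofReal_mul]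
  have h1 := key (ξ 0) (ξ 1) (ξ 2) (v 0).re (v 1).re (v 2).re
  have h2 := key (ξ 0) (ξ 1) (ξ 2) (v 0).im (v 1).im (v 2).im
  nlinarith

/-- A vector orthogonal to `ξ` is controlled through the product with `ξ`. -/
theorem norm_mul_norm_inner_le {ξ : R3} {u : C3} (h : realDot ξ u = 0) (v : C3) :
    ‖ξ‖ * ‖inner ℂ u v‖ ≤ ‖u‖ * ‖iCross ξ v‖ := by
  rcases eq_or_ne ξ 0 with rfl | hξ
  · simp only [norm_zero, zero_mul]; positivity
  have hξ' : 0 < ‖ξ‖ := norm_pos_iff.mpr hξ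
  -- Replace `|ξ|² u` by its double cross product and move one factor onto `v`.
  have h1 : ((‖ξ‖ ^ 2 : ℝ) : ℂ) * inner ℂ u v = inner ℂ (iCross ξ u) (iCross ξ v) := by
    rw [← inner_iCross_left, iCross_iCross_of_realDot_eq_zero h, inner_smul_left,
      Complex.conj_ofReal]
  have h2 : ‖ξ‖ ^ 2 * ‖inner ℂ u v‖ ≤ ‖ξ‖ * ‖u‖ * ‖iCross ξ v‖ := by
    calc ‖ξ‖ ^ 2 * ‖inner ℂ u v‖ = ‖((‖ξ‖ ^ 2 : ℝ) : ℂ) * inner ℂ u v‖ := by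
          rw [norm_mul, Complex.norm_real, Real.norm_of_nonneg (by positivity)]
      _ ≤ ‖iCross ξ u‖ * ‖iCross ξ v‖ := by rw [h1]; exact norm_inner_le_norm _ _
      _ ≤ _ := by gcongr; exact norm_iCross_le ξ u
  refine le_of_mul_le_mul_left ?_ hξ'
  nlinarith

/-! ### Fourier coefficients in an abstract Hilbert space -/

/-- The Hilbert space of square-summable families of vectors in `ℂ³`. -/
abbrev SeqSpace (K : Type*) := lp (fun _ : K => C3) 2

section Coefficients

variable {K : Type*} {H : Type*} [NormedAddCommGroup H] [InnerProductSpace ℂ H]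

/-- The coefficient with index `k`. -/
def co (U : H ≃ₗᵢ[ℂ] SeqSpace K) (k : K) : H →ₗ[ℂ] C3 where
  toFun x := U x k
  map_add' x y := by simp
  map_smul' a x := by simp

theorem hasSum_co (U : H ≃ₗᵢ[ℂ] SeqSpace K) (x y : H) :
    HasSum (fun k => inner ℂ (co U k x) (co U k y)) (inner ℂ x y) := by
  rw [← U.inner_map_map x y]
  exact lp.hasSum_inner (U x) (U y)

theorem hasSum_norm_co (U : H ≃ₗᵢ[ℂ] SeqSpace K) (x : H) :
    HasSum (fun k => ‖co U k x‖ ^ 2) (‖x‖ ^ 2) := by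
  have h := Complex.hasSum_re (hasSum_co U x x)
  have e : ∀ z : C3, (inner ℂ z z).re = ‖z‖ ^ 2 := fun z => by
    rw [inner_self_eq_norm_sq_to_K]; norm_cast
  have e' : (inner ℂ x x).re = ‖x‖ ^ 2 := by
    rw [inner_self_eq_norm_sq_to_K]; norm_cast
  rw [e'] at h
  simpa only [e] using h

theorem norm_co_le (U : H ≃ₗᵢ[ℂ] SeqSpace K) (k : K) (x : H) : ‖co U k x‖ ≤ ‖x‖ := by
  rw [← U.norm_map x]
  exact lp.norm_apply_le_norm (by simp) (U x) k

/-- A family dominated by the coefficients of `x` is the family of coefficients of some `y`. -/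
theorem exists_co_eq (U : H ≃ₗᵢ[ℂ] SeqSpace K) (x : H) (f : K → C3) {c : ℝ} (hc : 0 ≤ c)
    (hf : ∀ k, ‖f k‖ ≤ c * ‖co U k x‖) :
    ∃ y : H, (∀ k, co U k y = f k) ∧ ‖y‖ ≤ c * ‖x‖ := by
  have hs := (hasSum_norm_co U x).mul_left (c ^ 2)
  have hle : ∀ k, ‖f k‖ ^ 2 ≤ c ^ 2 * ‖co U k x‖ ^ 2 := fun k => by
    rw [← mul_pow]; gcongr; exact hf k
  have hsum : Summable fun k => ‖f k‖ ^ 2 :=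
    Summable.of_nonneg_of_le (fun k => by positivity) hle hs.summable
  have hmem : Memℓp f 2 := by
    refine memℓp_gen ?_
    simpa using hsum
  refine ⟨U.symm ⟨f, hmem⟩, fun k => ?_, ?_⟩
  · change U (U.symm ⟨f, hmem⟩) k = f k
    rw [U.apply_symm_apply]
  · refine le_of_sq_le_sq ?_ (by positivity)
    have hy := hasSum_norm_co U (U.symm ⟨f, hmem⟩)
    have hk : ∀ k, co U k (U.symm ⟨f, hmem⟩) = f k := fun k => by
      change U (U.symm ⟨f, hmem⟩) k = f k
      rw [U.apply_symm_apply]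
    simp only [hk] at hy
    rw [mul_pow]
    exact hasSum_le hle hy hs

/-- If the coefficients of `x` and `y` away from `k₀` are almost orthogonal, then so are `x` and
`y` up to the contribution of `k₀`. -/
theorem norm_inner_sub_le [DecidableEq K] (U : H ≃ₗᵢ[ℂ] SeqSpace K) (k₀ : K) (x y a b : H) {c : ℝ}
    (hc : 0 ≤ c)
    (h : ∀ k, k ≠ k₀ → ‖inner ℂ (co U k x) (co U k y)‖ ≤ c * (‖co U k a‖ * ‖co U k b‖)) :
    ‖inner ℂ x y - inner ℂ (co U k₀ x) (co U k₀ y)‖ ≤ c * (‖a‖ * ‖b‖) := by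
  -- Overwriting the `k₀` term by zero subtracts it from the Parseval sum; Cauchy–Schwarz on finite
  -- partial sums then passes to the limit.
  have hs := (hasSum_co U x y).update k₀ 0
  have hs' : HasSum (Function.update (fun k => inner ℂ (co U k x) (co U k y)) k₀ 0)
      (inner ℂ x y - inner ℂ (co U k₀ x) (co U k₀ y)) := by
    rw [zero_sub, neg_add_eq_sub] at hs
    exact hs
  refine le_of_tendsto hs'.norm ?_
  refine Filter.Eventually.of_forall fun s => ?_
  calc ‖∑ k ∈ s, Function.update (fun k => inner ℂ (co U k x) (co U k y)) k₀ 0 k‖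
      ≤ ∑ k ∈ s, ‖Function.update (fun k => inner ℂ (co U k x) (co U k y)) k₀ (0 : ℂ) k‖ :=
        norm_sum_le _ _
    _ ≤ ∑ k ∈ s, c * (‖co U k a‖ * ‖co U k b‖) := by
        refine Finset.sum_le_sum fun k _ => ?_
        by_cases hk : k = k₀
        · subst hk; simp; positivity
        · simpa [Function.update_of_ne hk] using h k hk
    _ = c * ∑ k ∈ s, ‖co U k a‖ * ‖co U k b‖ := by rw [Finset.mul_sum]
    _ ≤ c * (√(∑ k ∈ s, ‖co U k a‖ ^ 2) * √(∑ k ∈ s, ‖co U k b‖ ^ 2)) := by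
        gcongr; exact Real.sum_mul_le_sqrt_mul_sqrt s _ _
    _ ≤ c * (‖a‖ * ‖b‖) := by
        have hb : ∀ z : H, √(∑ k ∈ s, ‖co U k z‖ ^ 2) ≤ ‖z‖ := fun z =>
          Real.sqrt_le_iff.mpr ⟨norm_nonneg _,
            sum_le_hasSum s (fun k _ => by positivity) (hasSum_norm_co U z)⟩
        gcongr
        · exact hb a
        · exact hb b

/-- The element with the single coefficient `c` at the index `0`. -/
def cst [DecidableEq K] [Zero K] (U : H ≃ₗᵢ[ℂ] SeqSpace K) : C3 →ₗ[ℂ] H where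
  toFun c := U.symm (lp.single 2 0 c)
  map_add' c d := by simp
  map_smul' a c := by simp

variable [DecidableEq K] [Zero K]

@[simp] theorem co_zero_cst (U : H ≃ₗᵢ[ℂ] SeqSpace K) (c : C3) : co U 0 (cst U c) = c := by
  simp [co, cst]

theorem co_cst_of_ne (U : H ≃ₗᵢ[ℂ] SeqSpace K) {k : K} (hk : k ≠ 0) (c : C3) :
    co U k (cst U c) = 0 := by
  simp [co, cst, hk]

theorem inner_cst_left (U : H ≃ₗᵢ[ℂ] SeqSpace K) (c : C3) (x : H) :
    inner ℂ (cst U c) x = inner ℂ c (co U 0 x) := by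
  rw [← U.inner_map_map]
  simp [cst, co, lp.inner_single_left]

theorem norm_cst (U : H ≃ₗᵢ[ℂ] SeqSpace K) (c : C3) : ‖cst U c‖ = ‖c‖ := by
  rw [← U.norm_map]
  simp [cst]

end Coefficients

/-! ### The estimate in an abstract Hilbert space -/

section Core

variable {K : Type*} {H : Type*} [NormedAddCommGroup H] [InnerProductSpace ℂ H]

/-- A linear operator that is coercive with constant `c` and bounded with constant `M`. -/
structure IsElliptic (c M : ℝ) (T : H →ₗ[ℂ] H) : Prop where
  coercive : ∀ x, c * ‖x‖ ^ 2 ≤ (inner ℂ x (T x)).re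
  bounded : ∀ x, ‖T x‖ ≤ M * ‖x‖

theorem norm_le_of_mul_sq_le {c a b : ℝ} (hc : 0 < c) (ha : 0 ≤ a) (hb : 0 ≤ b)
    (h : c * a ^ 2 ≤ a * b) : a ≤ b / c := by
  rw [le_div_iff₀ hc]
  rcases ha.eq_or_lt with rfl | ha'
  · simpa using hb
  · refine le_of_mul_le_mul_left ?_ ha'
    nlinarith

variable [DecidableEq K] [Zero K]

/-- Orthogonality of divergence-free and curl-free fields. It serves both cell problems, with
frequencies `2πk` for one and `2πk + κ` for the other. -/
theorem inner_eq_zero_of_co (U : H ≃ₗᵢ[ℂ] SeqSpace K) (ζ : K → R3) (hζ : ∀ k, k ≠ 0 → 1 ≤ ‖ζ k‖)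
    {x t : H} (h0 : inner ℂ (co U 0 x) (co U 0 t) = 0)
    (hx : ∀ k, k ≠ 0 → realDot (ζ k) (co U k x) = 0)
    (ht : ∀ k, k ≠ 0 → iCross (ζ k) (co U k t) = 0) : inner ℂ x t = 0 := by
  have h := norm_inner_sub_le U 0 x t x t le_rfl (fun k hk => by
    have h1 := norm_mul_norm_inner_le (hx k hk) (co U k t)
    rw [ht k hk, norm_zero, mul_zero] at h1
    nlinarith [hζ k hk, norm_nonneg (inner ℂ (co U k x) (co U k t))])
  rw [h0, sub_zero, zero_mul] at h
  exact norm_le_zero_iff.mp h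

/-- The energy of `y = x + s` equals the pairing of `s` with the mean flux, since `x` is orthogonal
to `T y`. This bounds the corrected field by its mean `s` and shows that the effective matrix
inherits the coercivity constant `c`. -/
theorem cell_estimates (U : H ≃ₗᵢ[ℂ] SeqSpace K) {c M : ℝ} (hc : 0 < c) {T : H →ₗ[ℂ] H}
    (hT : IsElliptic c M T) {x : H} {s : C3} (h0 : co U 0 x = 0)
    (hx : inner ℂ x (T (x + cst U s)) = 0) :
    ‖x + cst U s‖ ≤ M / c * ‖s‖ ∧ ‖s‖ ≤ ‖x + cst U s‖ ∧
      c * ‖s‖ ^ 2 ≤ (inner ℂ s (co U 0 (T (x + cst U s)))).re := by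
  set y := x + cst U s with hy
  have h1 : inner ℂ y (T y) = inner ℂ s (co U 0 (T y)) := by
    conv_lhs => rw [hy, inner_add_left, hx, zero_add, inner_cst_left]
  have h2 : ‖s‖ ≤ ‖y‖ := by
    have : co U 0 y = s := by simp [hy, h0]
    rw [← this]; exact norm_co_le U 0 y
  have h3 := hT.coercive y
  rw [h1] at h3
  have h4 : (inner ℂ s (co U 0 (T y))).re ≤ ‖s‖ * (M * ‖y‖) :=
    (Complex.re_le_norm _).trans ((norm_inner_le_norm _ _).trans (by
      gcongr; exact (norm_co_le U 0 _).trans (hT.bounded y)))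
  refine ⟨?_, h2, le_trans ?_ h3⟩
  · have hMy : 0 ≤ M * ‖y‖ := (norm_nonneg _).trans (hT.bounded y)
    rcases (norm_nonneg y).eq_or_lt with h | h
    · have : ‖s‖ = 0 := le_antisymm (h2.trans h.symm.le) (norm_nonneg _)
      rw [this, ← h]; simp
    · have hM : 0 ≤ M := nonneg_of_mul_nonneg_left hMy h
      have := norm_le_of_mul_sq_le hc (norm_nonneg y) (b := M * ‖s‖) (by positivity) (by nlinarith)
      rwa [mul_div_right_comm] at this
  · gcongr

/-- The bound for a vector that solves the dispersion relation. -/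
theorem dispersion_estimates {c r : ℝ} (hc : 0 < c) {θ : R3} {d m a b : C3}
    (hd : iCross θ a + b = -m)
    (ha : c * ‖iCross θ d‖ ^ 2 ≤ (inner ℂ (iCross θ d) a).re)
    (hb : c * ‖d‖ ^ 2 ≤ (inner ℂ d b).re) (hb' : ‖b‖ ≤ r * ‖d‖) (hr : 0 ≤ r) :
    ‖d‖ ≤ ‖m‖ / c ∧ ‖iCross θ d‖ ≤ ‖m‖ / c ∧
      ‖θ‖ * ‖iCross θ d‖ ≤ (1 + r / c) / c * ‖m‖ := by
  set s := iCross θ d with hs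
  have h1 : (inner ℂ s a).re + (inner ℂ d b).re ≤ ‖d‖ * ‖m‖ := by
    -- The homogenised equation is tested with `d`, and `iθ ×` is moved from `a` onto `d`.
    have : inner ℂ s a + inner ℂ d b = -inner ℂ d m := by
      rw [hs, inner_iCross_left, ← inner_add_right, hd, inner_neg_right]
    rw [← Complex.add_re, this, Complex.neg_re]
    exact (neg_le_abs _).trans ((Complex.abs_re_le_norm _).trans (norm_inner_le_norm _ _))
  have h2 : ‖d‖ ≤ ‖m‖ / c := norm_le_of_mul_sq_le hc (norm_nonneg _) (norm_nonneg _) (by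
    nlinarith [sq_nonneg ‖s‖])
  have h3 : ‖s‖ ≤ ‖m‖ / c := by
    refine le_of_sq_le_sq ?_ (by positivity)
    have : ‖d‖ * ‖m‖ ≤ ‖m‖ / c * ‖m‖ := by gcongr
    have h4 : c * ‖s‖ ^ 2 ≤ ‖m‖ / c * ‖m‖ := by nlinarith [sq_nonneg ‖d‖]
    have h5 : c * (‖m‖ / c) ^ 2 = ‖m‖ / c * ‖m‖ := by field_simp
    refine le_of_mul_le_mul_left ?_ hc
    rw [h5]; exact h4
  refine ⟨h2, h3, ?_⟩
  -- Since `s` is orthogonal to `θ`, the product `|θ| |⟨s, a⟩|` is controlled by `iθ × a`, which the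
  -- equation expresses through `m` and `b` with no power of `θ`.
  have h4 := norm_mul_norm_inner_le (realDot_iCross θ d) a
  have h5 : ‖iCross θ a‖ ≤ (1 + r / c) * ‖m‖ := by
    have : iCross θ a = -m - b := by rw [← hd]; abel
    rw [this]
    calc ‖-m - b‖ ≤ ‖m‖ + ‖b‖ := by simpa using norm_sub_le (-m) b
      _ ≤ ‖m‖ + r * (‖m‖ / c) := by gcongr; exact hb'.trans (by gcongr)
      _ = _ := by ring
  have h6 : c * ‖s‖ ^ 2 ≤ ‖inner ℂ s a‖ := ha.trans (Complex.re_le_norm _)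
  rcases (norm_nonneg s).eq_or_lt with h | h
  · rw [← h, mul_zero]; positivity
  · have h7 : ‖θ‖ * (c * ‖s‖ ^ 2) ≤ ‖s‖ * ((1 + r / c) * ‖m‖) := by
      calc _ ≤ ‖θ‖ * ‖inner ℂ s a‖ := by gcongr
        _ ≤ _ := h4
        _ ≤ _ := by gcongr
    have h8 : c * (‖θ‖ * ‖s‖) ≤ (1 + r / c) * ‖m‖ := by
      refine le_of_mul_le_mul_left ?_ h
      nlinarith
    rw [div_mul_eq_mul_div, le_div_iff₀ hc]
    linarith

/-- A field with prescribed curl. -/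
theorem exists_curl_eq (U : H ≃ₗᵢ[ℂ] SeqSpace K) (p : K → R3) (hp : ∀ k, k ≠ 0 → 1 ≤ ‖p k‖)
    (hp0 : p 0 = 0) {w : H} (h0 : co U 0 w = 0) (hw : ∀ k, realDot (p k) (co U k w) = 0) :
    ∃ n : H, (∀ k, iCross (p k) (co U k n) = co U k w) ∧ ‖n‖ ≤ ‖w‖ := by
  obtain ⟨n, hn, hn'⟩ := exists_co_eq U w
    (fun k => (((‖p k‖ ^ 2)⁻¹ : ℝ) : ℂ) • iCross (p k) (co U k w)) zero_le_one (fun k => by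
      rw [norm_smul, Complex.norm_real, Real.norm_of_nonneg (by positivity), one_mul]
      -- At `k = 0` the frequency vanishes and the weight is `0⁻¹ = 0`, so the potential has zero
      -- mean.
      by_cases hk : k = 0
      · subst hk
        simp [hp0]
      · have h1 := hp k hk
        calc (‖p k‖ ^ 2)⁻¹ * ‖iCross (p k) (co U k w)‖
            ≤ (‖p k‖ ^ 2)⁻¹ * (‖p k‖ * ‖co U k w‖) := by gcongr; exact norm_iCross_le _ _
          _ = ‖p k‖⁻¹ * ‖co U k w‖ := by field_simp
          _ ≤ 1 * ‖co U k w‖ := by gcongr; exact inv_le_one_of_one_le₀ h1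
          _ = _ := one_mul _)
  refine ⟨n, fun k => ?_, by simpa using hn'⟩
  rw [hn, iCross_smul, iCross_iCross_of_realDot_eq_zero (hw k), smul_smul]
  by_cases hk : k = 0
  · subst hk; rw [h0, smul_zero]
  · have h1 : ‖p k‖ ≠ 0 := by linarith [hp k hk]
    rw [← Complex.ofReal_mul, inv_mul_cancel₀ (by positivity), Complex.ofReal_one, one_smul]

end Core

/-! ### Error estimate for the two-scale expansion -/

section Estimate

variable {K : Type*} {H : Type*} [NormedAddCommGroup H] [InnerProductSpace ℂ H]
variable [DecidableEq K] [Zero K]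

theorem le_two_mul_of_sq_add_sq_le {x y k : ℝ} (hx : 0 ≤ x) (hk : 0 ≤ k)
    (h : x ^ 2 + y ^ 2 ≤ k * (x + y)) : x ≤ 2 * k := by
  by_contra hlt
  push Not at hlt
  nlinarith [sq_nonneg (y - k / 2)]

/-- The constant in the estimate. -/
def coreConst (c M : ℝ) : ℝ :=
  2 * ((M * (M / c) * ((1 + M * (M / c) / c) / c) + (M * (M / c) / c + 1) +
    M * (M / c + 1) * ((1 + M * (M / c) / c) / c) + M * (M / c + 1) / c) / c) +
    (M / c + 1) * ((1 + M * (M / c) / c) / c)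

/-- The differential equations enter only as algebraic relations between coefficients, with `p k`
the periodic frequency and `p k + ε • θ` the twisted one. The cell field `w` is divergence-free for
the former, while `z₀` is curl-free for the latter. -/
theorem core_estimate (U : H ≃ₗᵢ[ℂ] SeqSpace K) {c M : ℝ} (hc : 0 < c) (hM : 0 ≤ M)
    {S T : H →ₗ[ℂ] H} (hS : IsElliptic c M S) (hT : IsElliptic c M T)
    {p : K → R3} (hp0 : p 0 = 0) (hp : ∀ k, k ≠ 0 → 1 ≤ ‖p k‖)
    {ε : ℝ} (hε : 0 < ε) {θ : R3} (hξ : ∀ k, k ≠ 0 → 1 ≤ ‖p k + ε • θ‖)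
    {d : C3} {w z₀ F X G : H}
    (hw0 : co U 0 w = 0) (hwdiv : ∀ k, realDot (p k) (co U k w) = 0)
    (hwT : ∀ k, k ≠ 0 → iCross (p k) (co U k (T (w + cst U (iCross θ d)))) = 0)
    (hz0 : co U 0 z₀ = 0) (hzcurl : ∀ k, iCross (p k + ε • θ) (co U k z₀) = 0)
    (hzS : ∀ k, k ≠ 0 → realDot (p k + ε • θ) (co U k (S (z₀ + cst U d))) = 0)
    (hG : ∀ k, realDot (p k + ε • θ) (co U k G) = 0)
    (hX : ∀ k, co U k X = ((ε⁻¹ : ℝ) : ℂ) • iCross (p k + ε • θ) (co U k F))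
    (hF : ∀ k, ((ε⁻¹ : ℝ) : ℂ) • iCross (p k + ε • θ) (co U k (T X)) + co U k (S F) = -co U k G)
    (hd : iCross θ (co U 0 (T (w + cst U (iCross θ d)))) + co U 0 (S (z₀ + cst U d)) =
      -co U 0 G) :
    ‖X - (w + cst U (iCross θ d))‖ ≤ coreConst c M * ε * ‖G‖ := by
  set s := iCross θ d with hs
  set y := w + cst U s with hy
  set z := z₀ + cst U d with hz
  have hεc : (ε : ℂ) ≠ 0 := by exact_mod_cast hε.ne'
  have hwy : inner ℂ w (T y) = 0 :=
    inner_eq_zero_of_co U p hp (by rw [hw0, inner_zero_left]) (fun k _ => hwdiv k) hwT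
  have hzz : inner ℂ z₀ (S z) = 0 := by
    rw [← inner_conj_symm, inner_eq_zero_of_co U _ hξ (by rw [hz0, inner_zero_right]) hzS
      (fun k _ => hzcurl k), map_zero]
  obtain ⟨hy1, hy2, hy3⟩ := cell_estimates U hc hT hw0 hwy
  obtain ⟨hz1, hz2, hz3⟩ := cell_estimates U hc hS hz0 hzz
  rw [← hy] at hy1 hy2 hy3
  rw [← hz] at hz1 hz2 hz3
  obtain ⟨n, hn, hn'⟩ := exists_curl_eq U p hp hp0 hw0 hwdiv
  obtain ⟨q, hq, hq'⟩ := exists_co_eq U n (fun k => iCross (ε • θ) (co U k n)) (norm_nonneg (ε • θ))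
    (fun k => norm_iCross_le _ _)
  have hκ : ‖ε • θ‖ = ε * ‖θ‖ := by rw [norm_smul, Real.norm_of_nonneg hε.le]
  have hm : ‖co U 0 G‖ ≤ ‖G‖ := norm_co_le U 0 G
  have hSz : ‖co U 0 (S z)‖ ≤ M * (M / c) * ‖d‖ := by
    calc ‖co U 0 (S z)‖ ≤ M * ‖z‖ := (norm_co_le U 0 _).trans (hS.bounded z)
      _ ≤ M * (M / c * ‖d‖) := by gcongr
      _ = _ := by ring
  obtain ⟨hd1, hs1, hs2⟩ := dispersion_estimates hc hd hy3 hz3 hSz (by positivity)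
  rw [← hs] at hs1 hs2
  -- the error and its curl
  set R := F - z - (ε : ℂ) • n with hR
  set v := X - (y + q) with hv
  have hvR : ∀ k, co U k v = ((ε⁻¹ : ℝ) : ℂ) • iCross (p k + ε • θ) (co U k R) := by
    intro k
    -- The gradient part `z₀` has no twisted curl, and the constant `d` lives at `k = 0`, where its
    -- twisted curl is `iκ × d = εs`.
    have h1 : iCross (p k + ε • θ) (co U k z) = (ε : ℂ) • co U k (cst U s) := by
      rw [hz, map_add, iCross_add, hzcurl, zero_add]
      by_cases hk : k = 0
      · subst hk
        rw [hp0, zero_add, co_zero_cst, co_zero_cst, iCross_smul_left]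
      · rw [co_cst_of_ne U hk, co_cst_of_ne U hk, iCross_zero, smul_zero]
    have h2 : iCross (p k + ε • θ) (co U k n) = co U k w + co U k q := by
      rw [iCross_add_left, hn, hq]
    have h3 : ((ε⁻¹ : ℝ) : ℂ) * ε = 1 := by
      rw [Complex.ofReal_inv, inv_mul_cancel₀ hεc]
    rw [hv, hR, map_sub, map_sub, map_sub, hX, iCross_sub, iCross_sub, h1, map_smul, iCross_smul,
      h2, map_add, hy, map_add, smul_sub, smul_sub, smul_smul, smul_smul, h3, one_smul, one_smul]
    abel
  have hvdiv : ∀ k, realDot (p k + ε • θ) (co U k v) = 0 := fun k => by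
    rw [hvR, ← iCross_smul, realDot_iCross]
  -- The Maxwell equation tested with `R`: at each frequency the cross product moves across the
  -- pairing, and the sum vanishes term by term.
  have hbal : inner ℂ v (T X) + inner ℂ R (S F + G) = 0 := by
    have h := (hasSum_co U v (T X)).add (hasSum_co U R (S F + G))
    refine h.unique ?_
    convert hasSum_zero with k
    rw [hvR, ← iCross_smul, inner_iCross_left, inner_smul_left, Complex.conj_ofReal,
      ← inner_smul_right, ← inner_add_right, map_add, ← add_assoc, hF, neg_add_cancel,
      inner_zero_right]
  have hE : inner ℂ v (T v) + inner ℂ R (S R) = -((inner ℂ v (T y) + inner ℂ R (S z + G)) +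
      inner ℂ v (T q) + (ε : ℂ) * inner ℂ R (S n)) := by
    have hXe : X = v + y + q := by rw [hv]; abel
    have hFe : F = R + z + (ε : ℂ) • n := by rw [hR]; abel
    have h1 : inner ℂ v (T X) = inner ℂ v (T v) + inner ℂ v (T y) + inner ℂ v (T q) := by
      conv_lhs => rw [hXe]
      simp only [map_add, inner_add_right]
    have h2 : inner ℂ R (S F + G) = inner ℂ R (S R) + inner ℂ R (S z + G) +
        (ε : ℂ) * inner ℂ R (S n) := by
      conv_lhs => rw [hFe]
      simp only [map_add, inner_add_right, map_smul, inner_smul_right]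
      ring
    rw [h1, h2] at hbal
    linear_combination hbal
  -- the leading terms cancel at the zero frequency
  have h00 : inner ℂ (co U 0 v) (co U 0 (T y)) + inner ℂ (co U 0 R) (co U 0 (S z + G)) = 0 := by
    have : co U 0 v = iCross θ (co U 0 R) := by
      rw [hvR, hp0, zero_add, iCross_smul_left, smul_smul, Complex.ofReal_inv,
        inv_mul_cancel₀ hεc, one_smul]
    rw [this, inner_iCross_left, ← inner_add_right, (co U 0).map_add (S z) G, ← add_assoc, hd,
      neg_add_cancel, inner_zero_right]
  -- Because `T y` is curl-free for the periodic frequency away from `k = 0`, its twisted curl there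
  -- is just `iκ × T y`, of size `ε |θ|`.
  have hE1 : ‖inner ℂ v (T y) - inner ℂ (co U 0 v) (co U 0 (T y))‖ ≤
      ε * ‖θ‖ * (‖v‖ * ‖T y‖) := by
    refine norm_inner_sub_le U 0 v (T y) v (T y) (by positivity) fun k hk => ?_
    have h1 := norm_mul_norm_inner_le (hvdiv k) (co U k (T y))
    rw [iCross_add_left, hwT k hk, zero_add] at h1
    have h2 := norm_iCross_le (ε • θ) (co U k (T y))
    rw [hκ] at h2
    calc _ ≤ ‖p k + ε • θ‖ * ‖inner ℂ (co U k v) (co U k (T y))‖ :=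
          le_mul_of_one_le_left (norm_nonneg _) (hξ k hk)
      _ ≤ _ := h1
      _ ≤ ‖co U k v‖ * (ε * ‖θ‖ * ‖co U k (T y)‖) := by gcongr
      _ = _ := by ring
  -- Here `S z + G` is the divergence-free factor and `iξ × R = εv`, so the bound involves `v`
  -- instead of `R` and gains `ε` without any power of `θ`.
  have hE2 : ‖inner ℂ R (S z + G) - inner ℂ (co U 0 R) (co U 0 (S z + G))‖ ≤
      ε * (‖v‖ * ‖S z + G‖) := by
    refine norm_inner_sub_le U 0 R (S z + G) v (S z + G) hε.le fun k hk => ?_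
    have h0 : realDot (p k + ε • θ) (co U k (S z + G)) = 0 := by
      rw [map_add, realDot_add, hzS k hk, hG, add_zero]
    have h1 := norm_mul_norm_inner_le h0 (co U k R)
    have h2 : ‖iCross (p k + ε • θ) (co U k R)‖ = ε * ‖co U k v‖ := by
      rw [hvR, norm_smul, Complex.norm_real, Real.norm_of_nonneg (by positivity),
        mul_inv_cancel_left₀ hε.ne']
    rw [h2, norm_inner_symm] at h1
    calc _ ≤ ‖p k + ε • θ‖ * ‖inner ℂ (co U k R) (co U k (S z + G))‖ :=
          le_mul_of_one_le_left (norm_nonneg _) (hξ k hk)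
      _ ≤ _ := h1
      _ = _ := by ring
  -- sizes
  set g := ‖G‖ with hg
  set K₁ := (1 + M * (M / c) / c) / c with hK₁
  have hg0 : 0 ≤ g := norm_nonneg _
  have hK₁0 : 0 ≤ K₁ := by positivity
  have hθs : ‖θ‖ * ‖s‖ ≤ K₁ * g := hs2.trans (by gcongr)
  have hsg : ‖s‖ ≤ g / c := hs1.trans (by gcongr)
  have hdg : ‖d‖ ≤ g / c := hd1.trans (by gcongr)
  have hw' : ‖w‖ ≤ (M / c + 1) * ‖s‖ := by
    have hwe : w = y - cst U s := by rw [hy]; abel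
    calc ‖w‖ ≤ ‖y‖ + ‖cst U s‖ := by rw [hwe]; exact norm_sub_le _ _
      _ ≤ M / c * ‖s‖ + ‖s‖ := by rw [norm_cst]; gcongr
      _ = _ := by ring
  -- The factor `|θ|` left by the previous pairing is absorbed by the bound on `|θ| |s|`, as `y` is
  -- linear in `s`.
  have hθy : ‖θ‖ * ‖T y‖ ≤ M * (M / c) * (K₁ * g) := by
    calc ‖θ‖ * ‖T y‖ ≤ ‖θ‖ * (M * (M / c * ‖s‖)) := by
          gcongr; exact (hT.bounded y).trans (by gcongr)
      _ = M * (M / c) * (‖θ‖ * ‖s‖) := by ring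
      _ ≤ _ := by gcongr
  have hSzG : ‖S z + G‖ ≤ (M * (M / c) / c + 1) * g := by
    calc ‖S z + G‖ ≤ ‖S z‖ + ‖G‖ := norm_add_le _ _
      _ ≤ M * (M / c * (g / c)) + g := by
          gcongr; exact (hS.bounded z).trans (by gcongr; exact hz1.trans (by gcongr))
      _ = _ := by ring
  have hqn : ‖q‖ ≤ ε * ((M / c + 1) * K₁ * g) := by
    calc ‖q‖ ≤ ε * ‖θ‖ * ‖n‖ := by rw [← hκ]; exact hq'
      _ ≤ ε * ‖θ‖ * ((M / c + 1) * ‖s‖) := by gcongr; exact hn'.trans hw'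
      _ = ε * ((M / c + 1) * (‖θ‖ * ‖s‖)) := by ring
      _ ≤ ε * ((M / c + 1) * (K₁ * g)) := by gcongr
      _ = _ := by ring
  have hTq : ‖T q‖ ≤ ε * (M * (M / c + 1) * K₁ * g) := by
    calc ‖T q‖ ≤ M * (ε * ((M / c + 1) * K₁ * g)) := (hT.bounded q).trans (by gcongr)
      _ = _ := by ring
  have hSn : ‖S n‖ ≤ M * (M / c + 1) / c * g := by
    calc ‖S n‖ ≤ M * ((M / c + 1) * (g / c)) := (hS.bounded n).trans (by
          gcongr; exact (hn'.trans hw').trans (by gcongr))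
      _ = _ := by ring
  set a₁ := M * (M / c) * K₁
  set a₂ := M * (M / c) / c + 1
  set a₃ := M * (M / c + 1) * K₁
  set a₄ := M * (M / c + 1) / c
  have ha : 0 ≤ a₁ ∧ 0 ≤ a₂ ∧ 0 ≤ a₃ ∧ 0 ≤ a₄ := by
    refine ⟨?_, ?_, ?_, ?_⟩ <;> positivity
  obtain ⟨ha1, ha2, ha3, ha4⟩ := ha
  have hmain : ‖inner ℂ v (T v) + inner ℂ R (S R)‖ ≤
      ε * ((a₁ + a₂ + a₃ + a₄) * g) * (‖v‖ + ‖R‖) := by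
    rw [hE, norm_neg]
    have e1 : inner ℂ v (T y) + inner ℂ R (S z + G) =
        (inner ℂ v (T y) - inner ℂ (co U 0 v) (co U 0 (T y))) +
        (inner ℂ R (S z + G) - inner ℂ (co U 0 R) (co U 0 (S z + G))) := by
      linear_combination h00
    rw [e1]
    have t1 : ‖inner ℂ v (T y) - inner ℂ (co U 0 v) (co U 0 (T y))‖ ≤ ε * (a₁ * g) * ‖v‖ := by
      refine hE1.trans ?_
      calc ε * ‖θ‖ * (‖v‖ * ‖T y‖) = ε * (‖θ‖ * ‖T y‖) * ‖v‖ := by ring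
        _ ≤ ε * (M * (M / c) * (K₁ * g)) * ‖v‖ := by gcongr
        _ = _ := by simp only [a₁]; ring
    have t2 : ‖inner ℂ R (S z + G) - inner ℂ (co U 0 R) (co U 0 (S z + G))‖ ≤
        ε * (a₂ * g) * ‖v‖ := by
      refine hE2.trans ?_
      calc ε * (‖v‖ * ‖S z + G‖) = ε * ‖S z + G‖ * ‖v‖ := by ring
        _ ≤ _ := by gcongr
    have t3 : ‖inner ℂ v (T q)‖ ≤ ε * (a₃ * g) * ‖v‖ := by
      refine (norm_inner_le_norm _ _).trans ?_
      rw [mul_comm]; gcongr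
    have t4 : ‖(ε : ℂ) * inner ℂ R (S n)‖ ≤ ε * (a₄ * g) * ‖R‖ := by
      rw [norm_mul, Complex.norm_real, Real.norm_of_nonneg hε.le, mul_assoc]
      gcongr
      refine (norm_inner_le_norm _ _).trans ?_
      rw [mul_comm]; gcongr
    refine (norm_add₃_le.trans (add_le_add (add_le_add ((norm_add_le _ _).trans
      (add_le_add t1 t2)) t3) t4)).trans ?_
    have : 0 ≤ ε * (a₄ * g) * ‖v‖ + ε * (a₁ * g) * ‖R‖ + ε * (a₂ * g) * ‖R‖ +
      ε * (a₃ * g) * ‖R‖ := by positivity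
    linarith
  -- Coercivity makes the left side at least `c (‖v‖² + ‖R‖²)`, while the right side is linear in
  -- `‖v‖ + ‖R‖`.
  have hvb : ‖v‖ ≤ 2 * (ε * ((a₁ + a₂ + a₃ + a₄) * g) / c) := by
    refine le_two_mul_of_sq_add_sq_le (y := ‖R‖) (norm_nonneg _) (by positivity) ?_
    have h1 := (Complex.re_le_norm _).trans hmain
    rw [Complex.add_re] at h1
    rw [div_mul_eq_mul_div, le_div_iff₀ hc]
    linarith [hT.coercive v, hS.coercive R]
  have : X - y = v + q := by rw [hv]; abel
  rw [this]
  refine (norm_add_le _ _).trans ((add_le_add hvb hqn).trans (le_of_eq ?_))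
  simp only [coreConst, a₁, a₂, a₃, a₄, hK₁]
  ring

end Estimate

/-! ### The homogenised matrices -/

section Matrices

/-- A complex matrix acting on `ℂ³`. -/
def cAct (P : Matrix (Fin 3) (Fin 3) ℂ) (v : C3) : C3 := WithLp.toLp 2 (P.mulVec v.ofLp)

theorem cAct_mul (P P' : Matrix (Fin 3) (Fin 3) ℂ) (v : C3) :
    cAct (P * P') v = cAct P (cAct P' v) := by
  simp [cAct, Matrix.mulVec_mulVec]

theorem cAct_add (P P' : Matrix (Fin 3) (Fin 3) ℂ) (v : C3) :
    cAct (P + P') v = cAct P v + cAct P' v := by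
  simp [cAct, Matrix.add_mulVec]

theorem cAct_crossMatrix (θ : R3) (v : C3) :
    cAct (crossMatrix (iVec θ)) v = iCross θ v := by
  simp [cAct, iCross, crossMatrix_mulVec]

theorem isUnit_det_of_coercive {P : Matrix (Fin 3) (Fin 3) ℂ} {c : ℝ} (hc : 0 < c)
    (h : ∀ v, c * ‖v‖ ^ 2 ≤ (inner ℂ v (cAct P v)).re) : IsUnit P.det := by
  rw [isUnit_iff_ne_zero]
  intro h0
  obtain ⟨v, hv, hPv⟩ := Matrix.exists_mulVec_eq_zero_iff.mpr h0
  have h1 := h (WithLp.toLp 2 v)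
  simp only [cAct, hPv, WithLp.toLp_zero, inner_zero_right, Complex.zero_re] at h1
  have h2 : ‖(WithLp.toLp 2 v : C3)‖ ^ 2 ≤ 0 := by
    by_contra hlt
    push Not at hlt
    nlinarith
  have h3 : (WithLp.toLp 2 v : C3) = 0 := by
    rw [← norm_eq_zero]; exact pow_eq_zero_iff two_ne_zero |>.mp (le_antisymm h2 (sq_nonneg _))
  exact hv (by simpa using h3)

/-- With `X` the matrix of `iθ × Ã iθ ×`, the formula for `d` collapses to `-(X + Â)⁻¹ m`. The sum
is invertible because `iθ ×` is Hermitian, so `X` only adds a nonnegative real part to the form of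
`Â`. -/
theorem dVec_spec {Ahat Atil : Matrix (Fin 3) (Fin 3) ℂ} {c : ℝ} (hc : 0 < c)
    (hhat : ∀ v, c * ‖v‖ ^ 2 ≤ (inner ℂ v (cAct Ahat v)).re)
    (htil : ∀ v, c * ‖v‖ ^ 2 ≤ (inner ℂ v (cAct Atil v)).re) (θ : R3) (m : C3) :
    iCross θ (cAct Atil (iCross θ (dVec Ahat Atil θ m))) + cAct Ahat (dVec Ahat Atil θ m) = -m := by
  set X := crossMatrix (iVec θ) * Atil * crossMatrix (iVec θ) with hX
  have hXv : ∀ v, cAct X v = iCross θ (cAct Atil (iCross θ v)) := fun v => by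
    rw [hX, cAct_mul, cAct_mul, cAct_crossMatrix, cAct_crossMatrix]
  have hA := isUnit_det_of_coercive hc hhat
  have hB : IsUnit (X + Ahat).det := by
    refine isUnit_det_of_coercive hc fun v => ?_
    rw [cAct_add, inner_add_right, hXv, ← inner_iCross_left, Complex.add_re]
    have h1 := htil (iCross θ v)
    have h2 := hhat v
    nlinarith [sq_nonneg ‖iCross θ v‖]
  have h1 : X * Ahat⁻¹ + 1 = (X + Ahat) * Ahat⁻¹ := by
    rw [add_mul, Matrix.mul_nonsing_inv _ hA]
  have h2 : dVec Ahat Atil θ m = -cAct (X + Ahat)⁻¹ m := by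
    simp only [dVec, ← hX]
    rw [h1, Matrix.mul_inv_rev, Matrix.nonsing_inv_nonsing_inv _ hA, ← mul_assoc,
      Matrix.nonsing_inv_mul _ hA, one_mul]
    simp [cAct]
  rw [← hXv, ← cAct_add, h2]
  have h3 : ∀ (P : Matrix (Fin 3) (Fin 3) ℂ) (v : C3), cAct P (-v) = -cAct P v := fun P v => by
    simp [cAct, Matrix.mulVec_neg]
  rw [h3, ← cAct_mul, Matrix.mul_nonsing_inv _ hB]
  simp [cAct]

variable {K : Type*} {H : Type*} [NormedAddCommGroup H] [InnerProductSpace ℂ H]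
variable [DecidableEq K] [Zero K]

/-- The linear combination of the columns `W j` with the coefficients `s j`. -/
def comb (W : Fin 3 → H) (s : C3) : H := ∑ j, s j • W j

/-- The matrix with columns `∫ T (W j + e j)`. -/
def effMatrix (U : H ≃ₗᵢ[ℂ] SeqSpace K) (T : H →ₗ[ℂ] H) (W : Fin 3 → H) :
    Matrix (Fin 3) (Fin 3) ℂ :=
  Matrix.of fun i j => co U 0 (T (W j + cst U (basisVec j))) i

theorem sum_smul_basisVec (s : C3) : ∑ j, s j • basisVec j = s := by
  apply ext_C3 <;> simp [Fin.sum_univ_three, basisVec]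

theorem comb_add_cst (U : H ≃ₗᵢ[ℂ] SeqSpace K) (W : Fin 3 → H) (s : C3) :
    comb W s + cst U s = ∑ j, s j • (W j + cst U (basisVec j)) := by
  simp only [smul_add, Finset.sum_add_distrib, ← map_smul, ← map_sum, sum_smul_basisVec, comb]

theorem co_map_comb (U : H ≃ₗᵢ[ℂ] SeqSpace K) (T : H →ₗ[ℂ] H) (W : Fin 3 → H) (s : C3) (k : K) :
    co U k (T (comb W s + cst U s)) = ∑ j, s j • co U k (T (W j + cst U (basisVec j))) := by
  simp only [comb_add_cst, map_sum, map_smul]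

theorem cAct_effMatrix (U : H ≃ₗᵢ[ℂ] SeqSpace K) (T : H →ₗ[ℂ] H) (W : Fin 3 → H) (s : C3) :
    cAct (effMatrix U T W) s = co U 0 (T (comb W s + cst U s)) := by
  rw [co_map_comb]
  apply ext_C3 <;>
    simp [cAct, effMatrix, Matrix.mulVec, dotProduct, Fin.sum_univ_three, mul_comm] <;> ring

/-- The relations for the columns pass to their combinations by linearity. They also give the
coercivity of both effective matrices, so that the formula for `d` does solve the homogenised
equation. -/
theorem core_estimate_columns (U : H ≃ₗᵢ[ℂ] SeqSpace K) {c M : ℝ} (hc : 0 < c) (hM : 0 ≤ M)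
    {S T : H →ₗ[ℂ] H} (hS : IsElliptic c M S) (hT : IsElliptic c M T)
    {p : K → R3} (hp0 : p 0 = 0) (hp : ∀ k, k ≠ 0 → 1 ≤ ‖p k‖)
    {ε : ℝ} (hε : 0 < ε) {θ : R3} (hξ : ∀ k, k ≠ 0 → 1 ≤ ‖p k + ε • θ‖)
    {W g : Fin 3 → H} {F X G : H}
    (hW0 : ∀ j, co U 0 (W j) = 0) (hWdiv : ∀ k j, realDot (p k) (co U k (W j)) = 0)
    (hWT : ∀ k, k ≠ 0 → ∀ j, iCross (p k) (co U k (T (W j + cst U (basisVec j)))) = 0)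
    (hg0 : ∀ j, co U 0 (g j) = 0) (hgcurl : ∀ k j, iCross (p k + ε • θ) (co U k (g j)) = 0)
    (hgS : ∀ k, k ≠ 0 → ∀ j, realDot (p k + ε • θ) (co U k (S (g j + cst U (basisVec j)))) = 0)
    (hG : ∀ k, realDot (p k + ε • θ) (co U k G) = 0)
    (hX : ∀ k, co U k X = ((ε⁻¹ : ℝ) : ℂ) • iCross (p k + ε • θ) (co U k F))
    (hF : ∀ k, ((ε⁻¹ : ℝ) : ℂ) • iCross (p k + ε • θ) (co U k (T X)) + co U k (S F) = -co U k G)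
    {d : C3} (hd : d = dVec (effMatrix U S g) (effMatrix U T W) θ (co U 0 G)) :
    ‖X - (comb W (iCross θ d) + cst U (iCross θ d))‖ ≤ coreConst c M * ε * ‖G‖ := by
  have hco : ∀ (V : Fin 3 → H) (s : C3) (k : K), co U k (comb V s) = ∑ j, s j • co U k (V j) :=
    fun V s k => by simp only [comb, map_sum, map_smul]
  have hcross : ∀ (ζ : R3) (s : C3) (v : Fin 3 → C3), (∀ j, iCross ζ (v j) = 0) →
      iCross ζ (∑ j, s j • v j) = 0 := fun ζ s v h => by
    rw [← iCrossLin_apply, map_sum]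
    simp [h]
  have w0 : ∀ s, co U 0 (comb W s) = 0 := fun s => by simp [hco, hW0]
  have wdiv : ∀ s k, realDot (p k) (co U k (comb W s)) = 0 := fun s k => by
    rw [hco]; exact realDot_sum_smul _ _ _ (hWdiv k)
  have wT : ∀ s k, k ≠ 0 → iCross (p k) (co U k (T (comb W s + cst U s))) = 0 := fun s k hk => by
    rw [co_map_comb]; exact hcross _ _ _ (hWT k hk)
  have g0 : ∀ s, co U 0 (comb g s) = 0 := fun s => by simp [hco, hg0]
  have gcurl : ∀ s k, iCross (p k + ε • θ) (co U k (comb g s)) = 0 := fun s k => by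
    rw [hco]; exact hcross _ _ _ (hgcurl k)
  have gS : ∀ s k, k ≠ 0 → realDot (p k + ε • θ) (co U k (S (comb g s + cst U s))) = 0 :=
    fun s k hk => by rw [co_map_comb]; exact realDot_sum_smul _ _ _ (hgS k hk)
  have hhat : ∀ v, c * ‖v‖ ^ 2 ≤ (inner ℂ v (cAct (effMatrix U S g) v)).re := fun v => by
    rw [cAct_effMatrix]
    refine (cell_estimates U hc hS (g0 v) ?_).2.2
    rw [← inner_conj_symm, inner_eq_zero_of_co U _ hξ (by rw [g0, inner_zero_right]) (gS v)
      (fun k _ => gcurl v k), map_zero]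
  have htil : ∀ v, c * ‖v‖ ^ 2 ≤ (inner ℂ v (cAct (effMatrix U T W) v)).re := fun v => by
    rw [cAct_effMatrix]
    exact (cell_estimates U hc hT (w0 v) (inner_eq_zero_of_co U p hp
      (by rw [w0, inner_zero_left]) (fun k _ => wdiv v k) (wT v))).2.2
  have hspec := dVec_spec hc hhat htil θ (co U 0 G)
  rw [← hd, cAct_effMatrix, cAct_effMatrix] at hspec
  exact core_estimate U hc hM hS hT hp0 hp hε hξ (w0 _) (wdiv _) (wT _) (g0 d) (gcurl d) (gS d) hG
    hX hF hspec

end Matrices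

/-! ### Real matrices acting on complex vectors -/

theorem act_add (M : M3) (u v : C3) : act M (u + v) = act M u + act M v := by
  simp [act, Matrix.mulVec_add]

theorem act_smul (M : M3) (a : ℂ) (v : C3) : act M (a • v) = a • act M v := by
  simp [act, Matrix.mulVec_smul]

theorem act_mul (M M' : M3) (v : C3) : act (M * M') v = act M (act M' v) := by
  have : (M * M').map (fun t : ℝ => (t : ℂ)) =
      M.map (fun t : ℝ => (t : ℂ)) * M'.map (fun t : ℝ => (t : ℂ)) :=
    Matrix.map_mul (f := Complex.ofRealHom)
  simp [act, this, Matrix.mulVec_mulVec]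

theorem act_one (v : C3) : act 1 v = v := by
  have : (1 : M3).map (fun t : ℝ => (t : ℂ)) = 1 :=
    Matrix.map_one _ Complex.ofReal_zero Complex.ofReal_one
  simp [act, this]

/-- The linear map `v ↦ M v`. -/
def actLin (M : M3) : C3 →ₗ[ℂ] C3 where
  toFun := act M
  map_add' := act_add M
  map_smul' := act_smul M

theorem act_sub (M : M3) (u v : C3) : act M (u - v) = act M u - act M v :=
  (actLin M).map_sub u v

theorem act_apply (M : M3) (v : C3) (i : Fin 3) : act M v i = ∑ j, (M i j : ℂ) * v j := by
  simp [act, Matrix.mulVec, dotProduct]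

theorem dot_conjVec (u v : C3) : dot u (conjVec v) = inner ℂ v u := by
  simp [dot, conjVec, PiLp.inner_apply]

theorem inner_act_of_isSymm {M : M3} (hM : M.IsSymm) (u v : C3) :
    inner ℂ (act M u) v = inner ℂ u (act M v) := by
  have h : ∀ i j, M i j = M j i := fun i j => hM.apply j i
  simp only [inner_C3, act_apply, Fin.sum_univ_three, map_add, map_mul, Complex.conj_ofReal]
  rw [h 1 0, h 2 0, h 2 1]
  ring

theorem inner_act_re (M : M3) (v : C3) :
    (inner ℂ v (act M v)).re = dotProduct (fun i => (v i).re) (M.mulVec fun i => (v i).re) +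
      dotProduct (fun i => (v i).im) (M.mulVec fun i => (v i).im) := by
  simp only [inner_C3, act_apply, Fin.sum_univ_three, dotProduct, Matrix.mulVec, Complex.add_re,
    Complex.mul_re, Complex.mul_im, Complex.add_im, Complex.conj_re, Complex.conj_im,
    Complex.ofReal_re, Complex.ofReal_im]
  ring

theorem normSq_C3 (v : C3) :
    ‖v‖ ^ 2 = dotProduct (fun i => (v i).re) (fun i => (v i).re) +
      dotProduct (fun i => (v i).im) (fun i => (v i).im) := by
  simp only [EuclideanSpace.norm_sq_eq, dotProduct, Fin.sum_univ_three,
    ← Complex.normSq_eq_norm_sq, Complex.normSq_apply]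
  ring

/-- Pointwise ellipticity of a symmetric matrix, on complex vectors. -/
structure MatBounds (α β : ℝ) (M : M3) : Prop where
  symm : M.IsSymm
  lower : ∀ v : C3, α * ‖v‖ ^ 2 ≤ (inner ℂ v (act M v)).re
  upper : ∀ v : C3, (inner ℂ v (act M v)).re ≤ β * ‖v‖ ^ 2

theorem IsCoefficient.exists_matBounds {A : R3 → M3} (hA : IsCoefficient A) :
    ∃ α β : ℝ, 0 < α ∧ α ≤ β ∧ ∀ x, MatBounds α β (A x) := by
  obtain ⟨α, β, hα, h⟩ := hA.elliptic
  refine ⟨α, β, hα, ?_, fun x => ⟨hA.symm x, fun v => ?_, fun v => ?_⟩⟩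
  -- Testing both bounds on a unit vector gives `α ≤ β`, and hence `β > 0`.
  · have := h 0 ![1, 0, 0]
    have h1 := this.1.trans this.2
    simpa [dotProduct, Fin.sum_univ_three] using h1
  · rw [inner_act_re, normSq_C3, mul_add]
    exact add_le_add (h x _).1 (h x _).1
  · rw [inner_act_re, normSq_C3, mul_add]
    exact add_le_add (h x _).2 (h x _).2

/-! ### Square roots and inverses of elliptic matrices -/

namespace MatBounds

variable {α β : ℝ} {M : M3}

theorem posSemidef (h : MatBounds α β M) (hα : 0 < α) : M.PosSemidef := by
  refine Matrix.PosSemidef.of_dotProduct_mulVec_nonneg ?_ fun v => ?_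
  · rw [Matrix.IsHermitian, Matrix.conjTranspose_eq_transpose_of_trivial]; exact h.symm
  · have h1 := h.lower (WithLp.toLp 2 fun i => (v i : ℂ))
    rw [inner_act_re] at h1
    simp only [Complex.ofReal_re, Complex.ofReal_im] at h1
    have h2 : dotProduct (fun _ : Fin 3 => (0 : ℝ)) (M.mulVec fun _ => 0) = 0 := by
      simp [dotProduct]
    rw [h2, add_zero] at h1
    have h3 : star v = v := by ext; simp
    rw [h3]
    exact le_trans (by positivity) h1

theorem isUnit_det (h : MatBounds α β M) (hα : 0 < α) : IsUnit M.det := by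
  have h1 := isUnit_det_of_coercive (P := M.map (fun t : ℝ => (t : ℂ))) hα h.lower
  have h2 : (M.map (fun t : ℝ => (t : ℂ))).det = ((M.det : ℝ) : ℂ) :=
    (Complex.ofRealHom.map_det M).symm
  rw [h2, isUnit_iff_ne_zero, Complex.ofReal_ne_zero] at h1
  exact isUnit_iff_ne_zero.mpr h1

theorem sqrt_mul_self (h : MatBounds α β M) (hα : 0 < α) : sqrtM M * sqrtM M = M :=
  sqrtM_mul_self (h.posSemidef hα)

theorem isUnit_det_sqrt (h : MatBounds α β M) (hα : 0 < α) : IsUnit (sqrtM M).det := by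
  have h1 := h.isUnit_det hα
  rw [← h.sqrt_mul_self hα, Matrix.det_mul] at h1
  exact isUnit_of_mul_isUnit_left h1

theorem sqrt_isSymm (M : M3) : (sqrtM M).IsSymm := by
  have := (sqrtM_posSemidef M).isHermitian
  rwa [Matrix.IsHermitian, Matrix.conjTranspose_eq_transpose_of_trivial] at this

theorem act_sqrt_act_sqrt (h : MatBounds α β M) (hα : 0 < α) (v : C3) :
    act (sqrtM M) (act (sqrtM M) v) = act M v := by
  rw [← act_mul, h.sqrt_mul_self hα]

theorem act_sqrt_act_sqrt_inv (h : MatBounds α β M) (hα : 0 < α) (v : C3) :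
    act (sqrtM M) (act (sqrtM M)⁻¹ v) = v := by
  rw [← act_mul, Matrix.mul_nonsing_inv _ (h.isUnit_det_sqrt hα), act_one]

theorem act_sqrt_inv_act_sqrt (h : MatBounds α β M) (hα : 0 < α) (v : C3) :
    act (sqrtM M)⁻¹ (act (sqrtM M) v) = v := by
  rw [← act_mul, Matrix.nonsing_inv_mul _ (h.isUnit_det_sqrt hα), act_one]

theorem act_inv (h : MatBounds α β M) (hα : 0 < α) (v : C3) :
    act M⁻¹ v = act (sqrtM M)⁻¹ (act (sqrtM M)⁻¹ v) := by
  rw [← act_mul, ← Matrix.mul_inv_rev, h.sqrt_mul_self hα]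

theorem act_act_inv (h : MatBounds α β M) (hα : 0 < α) (v : C3) : act M (act M⁻¹ v) = v := by
  rw [← act_mul, Matrix.mul_nonsing_inv _ (h.isUnit_det hα), act_one]

theorem norm_act_sqrt_sq (h : MatBounds α β M) (hα : 0 < α) (v : C3) :
    ‖act (sqrtM M) v‖ ^ 2 = (inner ℂ v (act M v)).re := by
  rw [← h.act_sqrt_act_sqrt hα, ← inner_act_of_isSymm (sqrt_isSymm M), inner_self_eq_norm_sq_to_K]
  norm_cast

theorem norm_act_sqrt_le (h : MatBounds α β M) (hα : 0 < α) (v : C3) :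
    ‖act (sqrtM M) v‖ ≤ √β * ‖v‖ := by
  rw [← Real.sqrt_sq (norm_nonneg (act (sqrtM M) v)), h.norm_act_sqrt_sq hα,
    ← Real.sqrt_sq (norm_nonneg v), ← Real.sqrt_mul' _ (by positivity)]
  exact Real.sqrt_le_sqrt (h.upper v)

/-- The bound on the quadratic form controls `M^{1/2}` by `√β`; applying the square root twice turns
this into a bound on `M`. -/
theorem norm_act_le (h : MatBounds α β M) (hα : 0 < α) (hβ : 0 ≤ β) (v : C3) :
    ‖act M v‖ ≤ β * ‖v‖ := by
  rw [← h.act_sqrt_act_sqrt hα]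
  calc _ ≤ √β * (√β * ‖v‖) := (h.norm_act_sqrt_le hα _).trans (by
        gcongr; exact h.norm_act_sqrt_le hα v)
    _ = _ := by rw [← mul_assoc, Real.mul_self_sqrt hβ]

theorem norm_act_sqrt_inv_le (h : MatBounds α β M) (hα : 0 < α) (v : C3) :
    ‖act (sqrtM M)⁻¹ v‖ ≤ (√α)⁻¹ * ‖v‖ := by
  set u := act (sqrtM M)⁻¹ v with hu
  have h1 : √α * ‖u‖ ≤ ‖v‖ := by
    have h2 : act (sqrtM M) u = v := h.act_sqrt_act_sqrt_inv hα v
    rw [← h2, ← Real.sqrt_sq (norm_nonneg (act (sqrtM M) u)), h.norm_act_sqrt_sq hα,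
      ← Real.sqrt_sq (norm_nonneg u), ← Real.sqrt_mul' _ (by positivity)]
    exact Real.sqrt_le_sqrt (h.lower u)
  rw [inv_mul_eq_div, le_div_iff₀ (by positivity)]
  linarith

theorem norm_act_inv_le (h : MatBounds α β M) (hα : 0 < α) (v : C3) :
    ‖act M⁻¹ v‖ ≤ α⁻¹ * ‖v‖ := by
  rw [h.act_inv hα]
  calc _ ≤ (√α)⁻¹ * ((√α)⁻¹ * ‖v‖) := (h.norm_act_sqrt_inv_le hα _).trans (by
        gcongr; exact h.norm_act_sqrt_inv_le hα v)
    _ = _ := by rw [← mul_assoc, ← mul_inv, Real.mul_self_sqrt hα.le]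

/-- Substitute `v = M u` and combine `|v| ≤ β |u|` with the coercivity of `M` at `u`. -/
theorem inv_lower (h : MatBounds α β M) (hα : 0 < α) (hβ : 0 < β) (v : C3) :
    α / β ^ 2 * ‖v‖ ^ 2 ≤ (inner ℂ v (act M⁻¹ v)).re := by
  set u := act M⁻¹ v with hu
  have hv : act M u = v := h.act_act_inv hα v
  have h1 := h.norm_act_le hα hβ.le u
  rw [hv] at h1
  have h2 := h.lower u
  rw [hv, ← inner_conj_symm, Complex.conj_re] at h2
  refine le_trans ?_ h2
  calc α / β ^ 2 * ‖v‖ ^ 2 ≤ α / β ^ 2 * (β * ‖u‖) ^ 2 := by gcongr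
    _ = _ := by field_simp

end MatBounds

/-! ### Measurability -/

theorem measurable_entries {Ω : Type*} [MeasurableSpace Ω] {f : Ω → M3}
    (hf : ∀ i j, Measurable fun x => f x i j) : Measurable fun x i j => f x i j :=
  measurable_pi_lambda _ fun i => measurable_pi_lambda _ fun j => hf i j

theorem measurable_inv_apply {Ω : Type*} [MeasurableSpace Ω] {f : Ω → M3}
    (hf : ∀ i j, Measurable fun x => f x i j) (i j : Fin 3) :
    Measurable fun x => (f x)⁻¹ i j := by
  have h := measurable_entries hf
  have hof : Continuous fun M : Fin 3 → Fin 3 → ℝ => (Matrix.of M : M3) := continuous_id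
  have hdet : Continuous fun M : Fin 3 → Fin 3 → ℝ => Matrix.det (Matrix.of M : M3) :=
    Continuous.matrix_det hof
  have hadj : Continuous fun M : Fin 3 → Fin 3 → ℝ => Matrix.adjugate (Matrix.of M : M3) i j :=
    (Continuous.matrix_adjugate hof).matrix_elem i j
  have e : (fun x => (f x)⁻¹ i j) = fun x => (Matrix.det (f x))⁻¹ * Matrix.adjugate (f x) i j := by
    funext x
    rw [Matrix.inv_def, Ring.inverse_eq_inv']
    rfl
  rw [e]
  exact (hdet.measurable.comp h).inv.mul (hadj.measurable.comp h)

open scoped MatrixOrder Matrix.Norms.L2Operator in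
-- The square root is continuous on positive semidefinite matrices; the operator norm supplies the
-- C⋆-algebra structure behind that continuity.
theorem measurable_sqrtM_apply {Ω : Type*} [MeasurableSpace Ω] {f : Ω → M3}
    (hf : ∀ i j, Measurable fun x => f x i j) (hpos : ∀ x, (f x).PosSemidef) (i j : Fin 3) :
    Measurable fun x => sqrtM (f x) i j := by
  have h := measurable_entries hf
  let s : Set (Fin 3 → Fin 3 → ℝ) := {M | (0 : M3) ≤ Matrix.of M}
  have hc : ContinuousOn (CFC.sqrt : M3 → M3) {a | 0 ≤ a} := CFC.continuousOn_sqrt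
  have hof : Continuous fun M : s => (Matrix.of M.1 : M3) := continuous_subtype_val
  have hcs : Continuous fun M : s => sqrtM (Matrix.of M.1 : M3) i j :=
    (hc.comp_continuous hof fun M => M.2).matrix_elem i j
  have hs : ∀ x, (fun i j => f x i j) ∈ s := fun x =>
    Matrix.nonneg_iff_posSemidef.mpr (hpos x)
  exact hcs.measurable.comp (h.subtype_mk (h := hs))

theorem aestronglyMeasurable_act {ν : Measure R3} {M : R3 → M3}
    (hM : ∀ i j, Measurable fun x => M x i j) {f : R3 → C3} (hf : AEStronglyMeasurable f ν) :
    AEStronglyMeasurable (fun x => act (M x) (f x)) ν := by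
  have h1 : ∀ i, AEStronglyMeasurable (fun x => act (M x) (f x) i) ν := fun i => by
    simp only [act_apply]
    refine Finset.aestronglyMeasurable_fun_sum _ fun j _ => ?_
    refine AEStronglyMeasurable.mul ?_ ?_
    · exact (Complex.measurable_ofReal.comp (hM i j)).aestronglyMeasurable
    · exact (EuclideanSpace.proj (𝕜 := ℂ) j).continuous.comp_aestronglyMeasurable hf
  have h2 : AEMeasurable (fun x => WithLp.ofLp (act (M x) (f x))) ν :=
    aemeasurable_pi_lambda _ fun i => (h1 i).aemeasurable
  exact ((PiLp.continuous_toLp 2 _).measurable.comp_aemeasurable h2).aestronglyMeasurable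

theorem memLp_act {ν : Measure R3} {M : R3 → M3} {c : ℝ}
    (hM : ∀ i j, Measurable fun x => M x i j) (hb : ∀ x v, ‖act (M x) v‖ ≤ c * ‖v‖)
    {f : R3 → C3} (hf : MemLp f 2 ν) : MemLp (fun x => act (M x) (f x)) 2 ν :=
  MemLp.of_le_mul hf (aestronglyMeasurable_act hM hf.1) (Filter.Eventually.of_forall fun x => hb x _)

/-! ### Exponentials -/

theorem expo_zero (x : R3) : expo 0 x = 1 := by simp [expo]

theorem expo_add (κ η x : R3) : expo (κ + η) x = expo κ x * expo η x := by
  simp only [expo, ← Complex.exp_add, PiLp.add_apply, add_mul, Finset.sum_add_distrib,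
    Complex.ofReal_add, mul_add]

theorem norm_expo (κ x : R3) : ‖expo κ x‖ = 1 := by
  rw [expo, mul_comm, Complex.norm_exp_ofReal_mul_I]

theorem conj_expo (κ x : R3) : (starRingEnd ℂ) (expo κ x) = expo (-κ) x := by
  simp [expo, ← Complex.exp_conj]

theorem expo_neg_mul_expo (κ x : R3) : expo (-κ) x * expo κ x = 1 := by
  rw [← expo_add, neg_add_cancel, expo_zero]

/-- The linear form `x ↦ κ · x`. -/
def phase (κ : R3) : R3 →L[ℝ] ℝ := ∑ j, κ j • EuclideanSpace.proj (𝕜 := ℝ) j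

theorem expo_eq (κ x : R3) : expo κ x = Complex.exp (Complex.I * (phase κ x : ℂ)) := by
  simp [expo, phase]

theorem hasFDerivAt_expo (κ x : R3) : HasFDerivAt (expo κ)
    (expo κ x • (Complex.I • Complex.ofRealCLM.comp (phase κ))) x := by
  have h1 : HasFDerivAt (fun y => ((phase κ y : ℝ) : ℂ)) (Complex.ofRealCLM.comp (phase κ)) x :=
    (Complex.ofRealCLM.comp (phase κ)).hasFDerivAt
  have h2 := (h1.const_mul Complex.I).cexp
  rw [← expo_eq] at h2
  exact h2.congr_of_eventuallyEq (Filter.Eventually.of_forall (expo_eq κ))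

theorem contDiff_expo (κ : R3) : ContDiff ℝ ∞ (expo κ) := by
  have : expo κ = fun x => Complex.exp (Complex.I * Complex.ofRealCLM (phase κ x)) := by
    funext x; exact expo_eq κ x
  rw [this]
  exact (contDiff_const.mul (Complex.ofRealCLM.contDiff.comp (phase κ).contDiff)).cexp

theorem continuous_expo (κ : R3) : Continuous (expo κ) := (contDiff_expo κ).continuous

theorem partialDeriv_expo_mul (κ : R3) (j : Fin 3) {f : R3 → ℂ} {x : R3}
    (hf : DifferentiableAt ℝ f x) :
    partialDeriv j (fun y => expo κ y * f y) x =
      expo κ x * (Complex.I * κ j * f x + partialDeriv j f x) := by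
  have h1 := ((hasFDerivAt_expo κ x).fun_mul hf.hasFDerivAt).fderiv
  rw [partialDeriv, h1]
  have : phase κ (EuclideanSpace.single j 1) = κ j := by simp [phase]
  simp [partialDeriv, this]
  ring

theorem partialDeriv_expo (κ : R3) (j : Fin 3) (x : R3) :
    partialDeriv j (expo κ) x = Complex.I * κ j * expo κ x := by
  have : phase κ (EuclideanSpace.single j 1) = κ j := by simp [phase]
  rw [partialDeriv, (hasFDerivAt_expo κ x).fderiv]
  simp [this]
  ring

/-- The frequency `2πk`. -/
def freq (k : Fin 3 → ℤ) : R3 := WithLp.toLp 2 fun j => 2 * Real.pi * k j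

theorem freq_apply (k : Fin 3 → ℤ) (j : Fin 3) : freq k j = 2 * Real.pi * k j := rfl

theorem freq_zero : freq 0 = 0 := by ext j; simp [freq_apply]

theorem freq_neg (k : Fin 3 → ℤ) : freq (-k) = -freq k := by
  ext j; simp [freq_apply]

theorem freq_add (k l : Fin 3 → ℤ) : freq (k + l) = freq k + freq l := by
  ext j; simp [freq_apply]; ring

theorem isPeriodic_expo_freq (k : Fin 3 → ℤ) : IsPeriodic (expo (freq k)) := by
  intro j x
  have : phase (freq k) (x + EuclideanSpace.single j 1) = phase (freq k) x + 2 * Real.pi * k j := by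
    rw [map_add]; simp [phase, freq_apply]
  rw [expo_eq, expo_eq, this]
  refine Complex.exp_eq_exp_iff_exists_int.mpr ⟨k j, ?_⟩
  push_cast
  ring

/-- A nonzero integer component of `k` contributes at least `2π`, of which `κ` can cancel at most
`π`. The remaining `π` is rounded down to `1`. -/
theorem one_le_norm_freq_add {κ : R3} (hκ : ∀ j, κ j ∈ Set.Ico (-Real.pi) Real.pi)
    {k : Fin 3 → ℤ} (hk : k ≠ 0) : 1 ≤ ‖freq k + κ‖ := by
  obtain ⟨j, hj⟩ := Function.ne_iff.mp hk
  have hπ := Real.pi_gt_three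
  have h1 : 1 ≤ |(freq k + κ) j| := by
    rw [PiLp.add_apply, freq_apply]
    obtain ⟨h2, h3⟩ := hκ j
    rcases lt_or_gt_of_ne hj with h | h
    · have : (k j : ℝ) ≤ -1 := by exact_mod_cast Int.le_sub_one_of_lt h
      rw [le_abs]; right; nlinarith
    · have : (1 : ℝ) ≤ k j := by exact_mod_cast h
      rw [le_abs]; left; nlinarith
  exact h1.trans (PiLp.norm_apply_le (freq k + κ) j)

theorem one_le_norm_freq {k : Fin 3 → ℤ} (hk : k ≠ 0) : 1 ≤ ‖freq k‖ := by
  have := one_le_norm_freq_add (κ := 0) (fun j => by simp [Real.pi_pos, Real.pi_nonneg]) hk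
  rwa [add_zero] at this

/-! ### Integration over the cell -/

theorem measurableSet_cell : MeasurableSet cell := by
  have : cell = ⋂ j, (fun x : R3 => x j) ⁻¹' Set.Ico (0 : ℝ) 1 := by ext; simp [cell]
  rw [this]
  exact MeasurableSet.iInter fun j =>
    (EuclideanSpace.proj (𝕜 := ℝ) j).continuous.measurable measurableSet_Ico

theorem cell_subset : cell ⊆ Metric.closedBall 0 2 := by
  intro x hx
  rw [mem_closedBall_zero_iff]
  refine le_of_sq_le_sq ?_ two_pos.le
  rw [normSq_R3]
  have h : ∀ j, x j ^ 2 ≤ 1 := fun j => by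
    obtain ⟨h1, h2⟩ := hx j
    nlinarith
  linarith [h 0, h 1, h 2]

variable {μ : Measure R3}

theorem IsAdmissibleMeasure.isProbabilityMeasure (hμ : IsAdmissibleMeasure μ) :
    IsProbabilityMeasure (onCell μ) :=
  ⟨by rw [onCell, Measure.restrict_apply_univ, hμ.cell_mass]⟩

theorem memLp_of_continuous {E : Type*} [NormedAddCommGroup E] [SecondCountableTopology E]
    [IsFiniteMeasure (onCell μ)] {f : R3 → E} (hf : Continuous f) (p : ENNReal) :
    MemLp f p (onCell μ) := by
  obtain ⟨C, hC⟩ := (isCompact_closedBall (0 : R3) 2).exists_bound_of_continuousOn hf.continuousOn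
  exact MemLp.of_bound hf.aestronglyMeasurable C
    ((ae_restrict_mem measurableSet_cell).mono fun x hx => hC x (cell_subset hx))

theorem integrable_of_continuous {E : Type*} [NormedAddCommGroup E] [SecondCountableTopology E]
    [IsFiniteMeasure (onCell μ)] {f : R3 → E} (hf : Continuous f) : Integrable f (onCell μ) :=
  memLp_one_iff_integrable.mp (memLp_of_continuous hf 1)

theorem continuous_partialDeriv (j : Fin 3) {f : R3 → ℂ} (hf : ContDiff ℝ ∞ f) :
    Continuous (partialDeriv j f) :=
  (hf.continuous_fderiv (by simp)).clm_apply continuous_const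

theorem IsPeriodic.mul {f g : R3 → ℂ} (hf : IsPeriodic f) (hg : IsPeriodic g) :
    IsPeriodic fun x => f x * g x := fun j x => by simp only [hf j x, hg j x]

/-- In a direction with `k j ≠ 0` the exponential is a nonzero multiple of its own derivative, which
has zero mean. -/
theorem integral_expo_freq (hμ : IsAdmissibleMeasure μ) {k : Fin 3 → ℤ} (hk : k ≠ 0) :
    ∫ x, expo (freq k) x ∂(onCell μ) = 0 := by
  obtain ⟨j, hj⟩ := Function.ne_iff.mp hk
  have h := hμ.deriv_mean_zero _ (contDiff_expo (freq k)) (isPeriodic_expo_freq k) j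
  simp only [partialDeriv_expo] at h
  rw [integral_const_mul] at h
  have h1 : (Complex.I * (freq k j : ℂ)) ≠ 0 := by
    refine mul_ne_zero Complex.I_ne_zero (Complex.ofReal_ne_zero.mpr ?_)
    rw [freq_apply]
    have : (k j : ℝ) ≠ 0 := by exact_mod_cast hj
    have := Real.pi_pos
    positivity
  exact (mul_eq_zero.mp h).resolve_left h1

/-- The Fourier coefficients of a derivative. -/
theorem integral_expo_partialDeriv (hμ : IsAdmissibleMeasure μ) (k : Fin 3 → ℤ) (κ : R3)
    (j : Fin 3) {f : R3 → ℂ} (hf : ContDiff ℝ ∞ f) (hp : IsPeriodic f) :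
    ∫ x, expo (-(freq k + κ)) x * partialDeriv j (fun y => expo κ y * f y) x ∂(onCell μ) =
      Complex.I * ((freq k + κ) j : ℝ) * ∫ x, expo (-freq k) x * f x ∂(onCell μ) := by
  have := hμ.isProbabilityMeasure
  have hd : ∀ x, DifferentiableAt ℝ f x := fun x => (hf.differentiable (by simp)) x
  have hsm : ContDiff ℝ ∞ fun y => expo (-freq k) y * f y := (contDiff_expo _).mul hf
  have h0 := hμ.deriv_mean_zero (fun y => expo (-freq k) y * f y) hsm
    (IsPeriodic.mul (by rw [← freq_neg]; exact isPeriodic_expo_freq _) hp) j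
  -- Integration by parts: the integrand is the derivative of a smooth periodic function plus the
  -- multiplier term.
  have e : ∀ x, expo (-(freq k + κ)) x * partialDeriv j (fun y => expo κ y * f y) x =
      partialDeriv j (fun y => expo (-freq k) y * f y) x +
        Complex.I * ((freq k + κ) j : ℝ) * (expo (-freq k) x * f x) := fun x => by
    rw [partialDeriv_expo_mul κ j (hd x), partialDeriv_expo_mul _ j (hd x), neg_add, expo_add]
    simp only [PiLp.neg_apply, PiLp.add_apply, Complex.ofReal_neg, Complex.ofReal_add]
    linear_combination (expo (-freq k) x * (Complex.I * κ j * f x + partialDeriv j f x)) *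
      expo_neg_mul_expo κ x
  simp only [e]
  rw [integral_add (integrable_of_continuous (continuous_partialDeriv j hsm))
    ((integrable_of_continuous hsm.continuous).const_mul _), h0, zero_add,
    integral_const_mul]

/-! ### Completeness of the exponentials -/

/-- The projection onto the torus. -/
def toTorus (x : R3) : UnitAddTorus (Fin 3) := fun j => (x j : UnitAddCircle)

/-- The representative of a point of the torus in the unit cell. -/
def ofTorus (t : UnitAddTorus (Fin 3)) : R3 :=
  WithLp.toLp 2 fun j => (AddCircle.measurableEquivIco (1 : ℝ) 0 (t j) : ℝ)

theorem measurable_toTorus : Measurable toTorus :=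
  measurable_pi_lambda _ fun j =>
    (AddCircle.measurable_mk' (a := (1 : ℝ))).comp (EuclideanSpace.proj (𝕜 := ℝ) j).continuous.measurable

theorem measurable_ofTorus : Measurable ofTorus := by
  refine (PiLp.continuous_toLp 2 _).measurable.comp (measurable_pi_lambda _ fun j => ?_)
  exact measurable_subtype_coe.comp
    ((AddCircle.measurableEquivIco (1 : ℝ) 0).measurable.comp (measurable_pi_apply j))

theorem ofTorus_toTorus {x : R3} (hx : x ∈ cell) : ofTorus (toTorus x) = x := by
  ext j
  have h := hx j
  exact AddCircle.equivIco_coe_of_mem (by simpa using h)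

theorem mFourier_toTorus (k : Fin 3 → ℤ) (x : R3) :
    UnitAddTorus.mFourier k (toTorus x) = expo (freq k) x := by
  simp only [UnitAddTorus.mFourier, ContinuousMap.coe_mk, toTorus, fourier_coe_apply,
    ← Complex.exp_sum, expo, freq_apply]
  congr 1
  push_cast
  rw [Finset.mul_sum]
  refine Finset.sum_congr rfl fun j _ => ?_
  ring

/-- Continuous functions orthogonal to `h` form a closed subspace `N` containing the characters,
hence everything by Stone–Weierstrass. Density of continuous functions in `L²(ν)` makes `h`
orthogonal to itself. -/
theorem ae_eq_zero_of_mFourier {ν : Measure (UnitAddTorus (Fin 3))} [IsFiniteMeasure ν]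
    {h : UnitAddTorus (Fin 3) → ℂ} (hh : MemLp h 2 ν)
    (h0 : ∀ k, ∫ t, UnitAddTorus.mFourier (-k) t * h t ∂ν = 0) : h =ᵐ[ν] 0 := by
  set F := hh.toLp with hF
  let N : Submodule ℂ C(UnitAddTorus (Fin 3), ℂ) :=
    (Submodule.span ℂ {F})ᗮ.comap (ContinuousMap.toLp 2 ν ℂ).toLinearMap
  have hN : IsClosed (N : Set C(UnitAddTorus (Fin 3), ℂ)) :=
    (Submodule.isClosed_orthogonal _).preimage (ContinuousMap.toLp 2 ν ℂ).continuous
  have hmem : ∀ k, UnitAddTorus.mFourier k ∈ N := fun k => by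
    change ContinuousMap.toLp 2 ν ℂ (UnitAddTorus.mFourier k) ∈ (Submodule.span ℂ {F})ᗮ
    rw [Submodule.mem_orthogonal_singleton_iff_inner_left, L2.inner_def, ← h0 k]
    refine integral_congr_ae ?_
    filter_upwards [ContinuousMap.coeFn_toLp (p := 2) (𝕜 := ℂ) ν (UnitAddTorus.mFourier k),
      hh.coeFn_toLp] with t h1 h2
    rw [h1, hF, h2, UnitAddTorus.mFourier_neg, RCLike.inner_apply, mul_comm]
  have htop : N = ⊤ := by
    rw [eq_top_iff, ← UnitAddTorus.span_mFourier_closure_eq_top]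
    refine Submodule.topologicalClosure_minimal _ (Submodule.span_le.mpr ?_) hN
    rintro _ ⟨k, rfl⟩
    exact hmem k
  have hdense := ContinuousMap.toLp_denseRange ℂ ν ℂ (p := 2) (by simp)
  have hall : F ∈ (Submodule.span ℂ {F})ᗮ := by
    refine closure_minimal ?_ (Submodule.isClosed_orthogonal (Submodule.span ℂ {F})) (hdense F)
    rintro _ ⟨P, rfl⟩
    have : P ∈ N := by rw [htop]; trivial
    exact this
  rw [Submodule.mem_orthogonal_singleton_iff_inner_left, inner_self_eq_zero] at hall
  exact hh.coeFn_toLp.symm.trans (by rw [← hF, hall]; exact Lp.coeFn_zero _ _ _)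

/-- The half-open cell is in measurable bijection with the compact torus, so the claim is
transported to the push-forward measure there. -/
theorem ae_eq_zero_of_expo [IsFiniteMeasure (onCell μ)] {h : R3 → ℂ} (hh : MemLp h 2 (onCell μ))
    (h0 : ∀ k, ∫ x, expo (-freq k) x * h x ∂(onCell μ) = 0) : h =ᵐ[onCell μ] 0 := by
  obtain ⟨h₁, hm, he⟩ := hh.1
  have hcell : ∀ᵐ x ∂(onCell μ), x ∈ cell := ae_restrict_mem measurableSet_cell
  have hT := measurable_toTorus.aemeasurable (μ := onCell μ)
  have hm' : StronglyMeasurable (h₁ ∘ ofTorus) := hm.comp_measurable measurable_ofTorus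
  have hcomp : (h₁ ∘ ofTorus) ∘ toTorus =ᵐ[onCell μ] h := by
    filter_upwards [hcell, he] with x hx hx'
    simp only [Function.comp, ofTorus_toTorus hx, hx']
  have h2 : MemLp (h₁ ∘ ofTorus) 2 (Measure.map toTorus (onCell μ)) :=
    (memLp_map_measure_iff hm'.aestronglyMeasurable hT).mpr (hh.ae_eq hcomp.symm)
  have h3 := ae_eq_zero_of_mFourier h2 fun k => by
    have hms : AEStronglyMeasurable (fun t => UnitAddTorus.mFourier (-k) t * (h₁ ∘ ofTorus) t)
        (Measure.map toTorus (onCell μ)) :=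
      (UnitAddTorus.mFourier (-k)).continuous.aestronglyMeasurable.mul hm'.aestronglyMeasurable
    rw [integral_map hT hms, ← h0 k]
    refine integral_congr_ae ?_
    filter_upwards [hcomp] with x hx
    rw [mFourier_toTorus, freq_neg, ← hx]
    rfl
  filter_upwards [ae_of_ae_map hT h3, hcomp] with x h4 h5
  rw [← h5]
  exact h4

/-! ### The Fourier transform on `L²(Q, dμ)` -/

/-- The vector Fourier coefficient `∫ e^{-2πik·x} f(x) dμ`. -/
def fcoef (μ : Measure R3) (k : Fin 3 → ℤ) (f : R3 → C3) : C3 :=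
  ∫ x, expo (-freq k) x • f x ∂(onCell μ)

section Fourier

variable {μ : Measure R3}

theorem memLp_expo_smul {E : Type*} [NormedAddCommGroup E] [NormedSpace ℂ E] (κ : R3) {f : R3 → E}
    {p : ENNReal} (hf : MemLp f p (onCell μ)) : MemLp (fun x => expo κ x • f x) p (onCell μ) :=
  MemLp.of_le hf ((continuous_expo κ).aestronglyMeasurable.smul hf.1)
    (Filter.Eventually.of_forall fun x => by rw [norm_smul, norm_expo, one_mul])

theorem integrable_expo_smul {E : Type*} [NormedAddCommGroup E] [NormedSpace ℂ E]
    [IsFiniteMeasure (onCell μ)] (κ : R3) {f : R3 → E} (hf : MemLp f 2 (onCell μ)) :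
    Integrable (fun x => expo κ x • f x) (onCell μ) :=
  (memLp_expo_smul κ hf).integrable (by norm_num)

theorem integrable_expo_mul [IsFiniteMeasure (onCell μ)] (κ : R3) {f : R3 → ℂ}
    (hf : MemLp f 2 (onCell μ)) : Integrable (fun x => expo κ x * f x) (onCell μ) :=
  integrable_expo_smul κ hf

theorem memLp_apply {f : R3 → C3} {p : ENNReal} (hf : MemLp f p (onCell μ)) (i : Fin 3) :
    MemLp (fun x => f x i) p (onCell μ) :=
  (EuclideanSpace.proj (𝕜 := ℂ) i).comp_memLp' hf

theorem integral_apply {f : R3 → C3} (hf : Integrable f (onCell μ)) (i : Fin 3) :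
    (∫ x, f x ∂(onCell μ)) i = ∫ x, f x i ∂(onCell μ) :=
  ((EuclideanSpace.proj (𝕜 := ℂ) i).integral_comp_comm hf).symm

theorem fcoef_apply [IsFiniteMeasure (onCell μ)] (k : Fin 3 → ℤ) {f : R3 → C3}
    (hf : MemLp f 2 (onCell μ)) (i : Fin 3) :
    fcoef μ k f i = ∫ x, expo (-freq k) x * f x i ∂(onCell μ) :=
  integral_apply (integrable_expo_smul _ hf) i

theorem fcoef_zero_index (f : R3 → C3) : fcoef μ 0 f = ∫ x, f x ∂(onCell μ) := by
  simp [fcoef, freq_zero, expo_zero]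

theorem fcoef_sub [IsFiniteMeasure (onCell μ)] (k : Fin 3 → ℤ) {f g : R3 → C3}
    (hf : MemLp f 2 (onCell μ)) (hg : MemLp g 2 (onCell μ)) :
    fcoef μ k (fun x => f x - g x) = fcoef μ k f - fcoef μ k g := by
  simp only [fcoef, smul_sub]
  exact integral_sub (integrable_expo_smul _ hf) (integrable_expo_smul _ hg)

theorem fcoef_congr (k : Fin 3 → ℤ) {f g : R3 → C3} (h : f =ᵐ[onCell μ] g) :
    fcoef μ k f = fcoef μ k g :=
  integral_congr_ae (h.mono fun x hx => by simp only [hx])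

theorem inner_expo_smul (κ : R3) (c : C3) (v : C3) (x : R3) :
    inner ℂ (expo κ x • c) v = inner ℂ c (expo (-κ) x • v) := by
  rw [inner_smul_left, inner_smul_right, conj_expo]

theorem integral_inner_expo [IsFiniteMeasure (onCell μ)] (k : Fin 3 → ℤ) (c : C3) {f : R3 → C3}
    (hf : MemLp f 2 (onCell μ)) :
    ∫ x, inner ℂ (expo (freq k) x • c) (f x) ∂(onCell μ) = inner ℂ c (fcoef μ k f) := by
  simp only [inner_expo_smul, fcoef]
  exact integral_inner (integrable_expo_smul _ hf) c

theorem norm_fcoef_le [IsProbabilityMeasure (onCell μ)] (k : Fin 3 → ℤ) {f : R3 → C3}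
    (hf : MemLp f 2 (onCell μ)) : ENNReal.ofReal ‖fcoef μ k f‖ ≤ eLpNorm f 2 (onCell μ) := by
  have h1 : ENNReal.ofReal ‖fcoef μ k f‖ ≤ ∫⁻ x, ‖expo (-freq k) x • f x‖ₑ ∂(onCell μ) := by
    rw [ofReal_norm]; exact enorm_integral_le_lintegral_enorm _
  refine h1.trans ?_
  rw [← eLpNorm_one_eq_lintegral_enorm]
  refine (eLpNorm_le_eLpNorm_of_exponent_le (q := 2) one_le_two (memLp_expo_smul _ hf).1).trans
    (le_of_eq ?_)
  exact eLpNorm_congr_norm_ae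
    (Filter.Eventually.of_forall fun x => by rw [norm_smul, norm_expo, one_mul])

variable (μ) in
/-- The isometry `c ↦ e^{2πik·x} c`. -/
def expoIso [IsProbabilityMeasure (onCell μ)] (k : Fin 3 → ℤ) : C3 →ₗᵢ[ℂ] Lp C3 2 (onCell μ) where
  toFun c := (memLp_expo_smul (freq k) (memLp_const c)).toLp
  map_add' c d := by
    rw [← MemLp.toLp_add]
    exact MemLp.toLp_congr _ _ (Filter.Eventually.of_forall fun x => smul_add _ _ _)
  map_smul' a c := by
    rw [RingHom.id_apply, ← MemLp.toLp_const_smul]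
    exact MemLp.toLp_congr _ _ (Filter.Eventually.of_forall fun x => smul_comm _ _ _)
  norm_map' c := by
    change ‖(memLp_expo_smul (freq k) (memLp_const c)).toLp‖ = ‖c‖
    rw [Lp.norm_toLp, eLpNorm_congr_norm_ae (g := fun _ => c)
      (Filter.Eventually.of_forall fun x => by rw [norm_smul, norm_expo, one_mul]),
      eLpNorm_const _ (by norm_num) (IsProbabilityMeasure.ne_zero _)]
    simp

theorem inner_expoIso [IsProbabilityMeasure (onCell μ)] (k : Fin 3 → ℤ) (c : C3) {f : R3 → C3}
    (hf : MemLp f 2 (onCell μ)) :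
    inner ℂ (expoIso μ k c) hf.toLp = inner ℂ c (fcoef μ k f) := by
  rw [L2.inner_def, ← integral_inner_expo k c hf]
  refine integral_congr_ae ?_
  filter_upwards [hf.coeFn_toLp, (memLp_expo_smul (freq k) (memLp_const c)).coeFn_toLp] with x h1 h2
  rw [h1]
  exact congrArg (fun v => inner ℂ v (f x)) h2

theorem orthogonalFamily_expoIso [IsProbabilityMeasure (onCell μ)] (hμ : IsAdmissibleMeasure μ) :
    OrthogonalFamily ℂ (fun _ : Fin 3 → ℤ => C3) (expoIso μ) := by
  intro k l hkl c d
  have hf : MemLp (fun x => expo (freq l) x • d) 2 (onCell μ) := memLp_expo_smul _ (memLp_const d)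
  change inner ℂ (expoIso μ k c) hf.toLp = 0
  rw [inner_expoIso]
  have h1 : fcoef μ k (fun x => expo (freq l) x • d) = 0 := by
    have h2 := integral_expo_freq hμ (sub_ne_zero.mpr hkl.symm)
    have h3 : ∀ x, expo (-freq k) x • expo (freq l) x • d = expo (freq (l - k)) x • d := fun x => by
      rw [smul_smul, ← expo_add, sub_eq_add_neg, freq_add, freq_neg, add_comm]
    simp only [fcoef, h3]
    rw [integral_smul_const, h2, zero_smul]
  rw [h1, inner_zero_right]

/-- A field orthogonal to every `e^{2πik·x} c` has vanishing Fourier coefficients, so each of its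
components is zero almost everywhere. -/
theorem isHilbertSum_expoIso [IsProbabilityMeasure (onCell μ)] (hμ : IsAdmissibleMeasure μ) :
    IsHilbertSum ℂ (fun _ : Fin 3 → ℤ => C3) (expoIso μ) := by
  refine IsHilbertSum.mk (orthogonalFamily_expoIso hμ) (le_of_eq ?_)
  symm
  rw [Submodule.topologicalClosure_eq_top_iff, Submodule.eq_bot_iff]
  intro f hf
  have hm := Lp.memLp f
  have h0 : ∀ k, fcoef μ k f = 0 := fun k => by
    have h1 : ∀ c, inner ℂ c (fcoef μ k f) = 0 := fun c => by
      rw [← inner_expoIso k c hm, Lp.toLp_coeFn]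
      exact (Submodule.mem_orthogonal _ _).mp hf _
        (Submodule.mem_iSup_of_mem k (LinearMap.mem_range_self _ c))
    exact inner_self_eq_zero.mp (h1 _)
  have h2 : ∀ i, (fun x => f x i) =ᵐ[onCell μ] 0 := fun i =>
    ae_eq_zero_of_expo (memLp_apply hm i) fun k => by
      rw [← fcoef_apply k hm i, h0 k]; rfl
  rw [Lp.eq_zero_iff_ae_eq_zero]
  filter_upwards [h2 0, h2 1, h2 2] with x e0 e1 e2
  exact ext_C3 e0 e1 e2

variable (μ) in
/-- The Fourier transform as a unitary operator. -/
def fourierEquiv [IsProbabilityMeasure (onCell μ)] (hμ : IsAdmissibleMeasure μ) :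
    Lp C3 2 (onCell μ) ≃ₗᵢ[ℂ] SeqSpace (Fin 3 → ℤ) :=
  (isHilbertSum_expoIso hμ).linearIsometryEquiv

theorem fourierEquiv_symm_single [IsProbabilityMeasure (onCell μ)] (hμ : IsAdmissibleMeasure μ)
    (k : Fin 3 → ℤ) (c : C3) :
    (fourierEquiv μ hμ).symm (lp.single 2 k c) = expoIso μ k c := by
  exact (isHilbertSum_expoIso hμ).linearIsometryEquiv_symm_apply_single c

theorem co_toLp [IsProbabilityMeasure (onCell μ)] (hμ : IsAdmissibleMeasure μ) (k : Fin 3 → ℤ)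
    {f : R3 → C3} (hf : MemLp f 2 (onCell μ)) :
    co (fourierEquiv μ hμ) k hf.toLp = fcoef μ k f := by
  refine ext_inner_left ℂ fun c => ?_
  rw [← inner_expoIso k c hf, ← fourierEquiv_symm_single hμ,
    ← (fourierEquiv μ hμ).inner_map_map, LinearIsometryEquiv.apply_symm_apply,
    lp.inner_single_left]
  rfl

theorem cst_eq [IsProbabilityMeasure (onCell μ)] (hμ : IsAdmissibleMeasure μ) (c : C3) :
    cst (fourierEquiv μ hμ) c = (memLp_const c).toLp := by
  change (fourierEquiv μ hμ).symm (lp.single 2 0 c) = _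
  rw [fourierEquiv_symm_single]
  exact MemLp.toLp_congr (memLp_expo_smul (freq 0) (memLp_const c)) _ (Filter.Eventually.of_forall fun x => by
    simp only [freq_zero, expo_zero, one_smul])

/-! ### Multiplication operators -/

/-- A measurable bounded matrix function. -/
structure IsBddMeas (M : R3 → M3) (c : ℝ) : Prop where
  measurable : ∀ i j, Measurable fun x => M x i j
  bound : ∀ x v, ‖act (M x) v‖ ≤ c * ‖v‖

theorem IsBddMeas.memLp {M : R3 → M3} {c : ℝ} (hM : IsBddMeas M c) {f : R3 → C3}
    (hf : MemLp f 2 (onCell μ)) : MemLp (fun x => act (M x) (f x)) 2 (onCell μ) :=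
  memLp_act hM.measurable hM.bound hf

variable (μ) in
/-- Multiplication by a matrix function. -/
def mulOp {M : R3 → M3} {c : ℝ} (hM : IsBddMeas M c) :
    Lp C3 2 (onCell μ) →ₗ[ℂ] Lp C3 2 (onCell μ) where
  toFun f := (hM.memLp (Lp.memLp f)).toLp
  map_add' f g := by
    rw [← MemLp.toLp_add]
    refine MemLp.toLp_congr _ _ ?_
    filter_upwards [Lp.coeFn_add f g] with x hx
    rw [hx, Pi.add_apply, act_add]; rfl
  map_smul' a f := by
    rw [RingHom.id_apply, ← MemLp.toLp_const_smul]
    refine MemLp.toLp_congr _ _ ?_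
    filter_upwards [Lp.coeFn_smul a f] with x hx
    rw [hx, Pi.smul_apply, act_smul]; rfl

theorem mulOp_toLp {M : R3 → M3} {c : ℝ} (hM : IsBddMeas M c) {f : R3 → C3}
    (hf : MemLp f 2 (onCell μ)) : mulOp μ hM hf.toLp = (hM.memLp hf).toLp :=
  MemLp.toLp_congr (hM.memLp (Lp.memLp _)) _ (hf.coeFn_toLp.mono fun x hx => by simp only [hx])

theorem norm_sq_eq_integral (f : Lp C3 2 (onCell μ)) :
    ‖f‖ ^ 2 = ∫ x, ‖f x‖ ^ 2 ∂(onCell μ) := by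
  have h : ((‖f‖ ^ 2 : ℝ) : ℂ) = ((∫ x, ‖f x‖ ^ 2 ∂(onCell μ) : ℝ) : ℂ) := by
    rw [← integral_complex_ofReal]
    have h1 : inner ℂ f f = ((‖f‖ ^ 2 : ℝ) : ℂ) := by
      rw [inner_self_eq_norm_sq_to_K]; norm_cast
    rw [← h1, L2.inner_def]
    refine integral_congr_ae (Filter.Eventually.of_forall fun x => ?_)
    simp only [inner_self_eq_norm_sq_to_K]
    norm_cast
  exact_mod_cast h

theorem isElliptic_mulOp {M : R3 → M3} {b c C : ℝ} (hM : IsBddMeas M b)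
    (hlow : ∀ x v, c * ‖v‖ ^ 2 ≤ (inner ℂ v (act (M x) v)).re) (hbC : b ≤ C) :
    IsElliptic c C (mulOp μ hM) := by
  refine ⟨fun f => ?_, fun f => ?_⟩
  · have hf := Lp.memLp f
    have hi : Integrable (fun x => inner ℂ (f x) ((mulOp μ hM f) x)) (onCell μ) :=
      L2.integrable_inner f (mulOp μ hM f)
    have hre : (inner ℂ f (mulOp μ hM f)).re =
        ∫ x, (inner ℂ (f x) ((mulOp μ hM f) x)).re ∂(onCell μ) := by
      rw [L2.inner_def]
      exact (integral_re hi).symm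
    rw [hre, norm_sq_eq_integral, ← integral_const_mul]
    refine integral_mono_ae (hf.integrable_norm_pow (by norm_num) |>.const_mul c) hi.re ?_
    filter_upwards [(hM.memLp hf).coeFn_toLp] with x hx
    have : (mulOp μ hM f) x = act (M x) (f x) := hx
    rw [this]
    exact hlow x (f x)
  · refine (Lp.norm_le_mul_norm_of_ae_le_mul (c := b) ?_).trans (by gcongr)
    filter_upwards [(hM.memLp (Lp.memLp f)).coeFn_toLp] with x hx
    have : (mulOp μ hM f) x = act (M x) (f x) := hx
    rw [this]
    exact hM.bound x (f x)

end Fourier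

/-! ### Fourier coefficients of weak curls and gradients -/

section Weak

theorem inner_iVec (ξ : R3) (v : C3) : inner ℂ (iVec ξ) v = -Complex.I * realDot ξ v := by
  simp only [inner_C3, iVec, realDot, Fin.sum_univ_three, map_mul, Complex.conj_I,
    Complex.conj_ofReal]
  ring

theorem realDot_eq_zero_of_inner_iVec {ξ : R3} {v : C3} (h : inner ℂ (iVec ξ) v = 0) :
    realDot ξ v = 0 := by
  rw [inner_iVec] at h
  exact (mul_eq_zero.mp h).resolve_left (neg_ne_zero.mpr Complex.I_ne_zero)

theorem iVec_add (ξ η : R3) : iVec (ξ + η) = iVec ξ + iVec η := by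
  apply ext_C3 <;> simp [iVec] <;> ring

theorem iCross_iVec (ξ : R3) (a : ℂ) : iCross ξ (a • iVec ξ) = 0 := by
  apply ext_C3 <;> simp [iCross_apply_zero, iCross_apply_one, iCross_apply_two, iVec] <;> ring

theorem iCross_zero_left (v : C3) : iCross 0 v = 0 := by
  apply ext_C3 <;> simp [iCross_apply_zero, iCross_apply_one, iCross_apply_two]

variable {μ : Measure R3}

theorem contDiff_apply_C3 {Φ : R3 → C3} (h : ContDiff ℝ ∞ Φ) (i : Fin 3) :
    ContDiff ℝ ∞ fun x => Φ x i :=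
  ((EuclideanSpace.proj (𝕜 := ℂ) i).restrictScalars ℝ).contDiff.comp h

theorem continuous_curl {Φ : R3 → C3} (h : ContDiff ℝ ∞ Φ) : Continuous (curl Φ) := by
  have hc : ∀ i j, Continuous fun x => partialDeriv j (fun y => Φ y i) x := fun i j =>
    continuous_partialDeriv j (contDiff_apply_C3 h i)
  refine (PiLp.continuous_toLp 2 _).comp (continuous_pi fun i => ?_)
  fin_cases i
  · exact (hc 2 1).sub (hc 1 2)
  · exact (hc 0 2).sub (hc 2 0)
  · exact (hc 1 0).sub (hc 0 1)

theorem continuous_gradient {f : R3 → ℂ} (h : ContDiff ℝ ∞ f) : Continuous (gradient f) :=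
  (PiLp.continuous_toLp 2 _).comp (continuous_pi fun j => continuous_partialDeriv j h)

theorem fcoef_curl [IsProbabilityMeasure (onCell μ)] (hμ : IsAdmissibleMeasure μ)
    (k : Fin 3 → ℤ) (κ : R3) {Φ : R3 → C3} (hΦ : ContDiff ℝ ∞ Φ) (hp : IsPeriodic Φ) :
    fcoef μ k (fun x => expo (-κ) x • curl (fun y => expo κ y • Φ y) x) =
      iCross (freq k + κ) (fcoef μ k Φ) := by
  have hs : ContDiff ℝ ∞ fun y => expo κ y • Φ y := (contDiff_expo κ).smul hΦ
  have hm : MemLp (fun x => expo (-κ) x • curl (fun y => expo κ y • Φ y) x) 2 (onCell μ) :=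
    memLp_expo_smul _ (memLp_of_continuous (continuous_curl hs) 2)
  have hm' : MemLp Φ 2 (onCell μ) := memLp_of_continuous hΦ.continuous 2
  have key : ∀ i j, ∫ x, expo (-(freq k + κ)) x *
      partialDeriv j (fun y => expo κ y * Φ y i) x ∂(onCell μ) =
      Complex.I * ((freq k + κ) j : ℝ) * fcoef μ k Φ i := fun i j => by
    rw [fcoef_apply k hm']
    exact integral_expo_partialDeriv hμ k κ j (contDiff_apply_C3 hΦ i)
      (fun l x => congrArg (fun v : C3 => v i) (hp l x))
  have hint : ∀ i j, Integrable (fun x => expo (-(freq k + κ)) x *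
      partialDeriv j (fun y => expo κ y * Φ y i) x) (onCell μ) := fun i j =>
    integrable_of_continuous ((continuous_expo _).mul
      (continuous_partialDeriv j ((contDiff_expo κ).mul (contDiff_apply_C3 hΦ i))))
  have comp : ∀ a i b j : Fin 3, ∫ x, expo (-freq k) x * (expo (-κ) x *
      (partialDeriv a (fun y => expo κ y * Φ y i) x -
        partialDeriv b (fun y => expo κ y * Φ y j) x)) ∂(onCell μ) =
      Complex.I * ((freq k + κ) a * fcoef μ k Φ i - (freq k + κ) b * fcoef μ k Φ j) :=
    fun a i b j => by
      have e : ∀ x, expo (-freq k) x * (expo (-κ) x *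
          (partialDeriv a (fun y => expo κ y * Φ y i) x -
            partialDeriv b (fun y => expo κ y * Φ y j) x)) =
          expo (-(freq k + κ)) x * partialDeriv a (fun y => expo κ y * Φ y i) x -
          expo (-(freq k + κ)) x * partialDeriv b (fun y => expo κ y * Φ y j) x := fun x => by
        rw [neg_add, expo_add]; ring
      simp only [e]
      rw [integral_sub (hint i a) (hint j b), key, key]
      ring
  refine ext_C3 ?_ ?_ ?_
  · rw [fcoef_apply k hm, iCross_apply_zero]; exact comp 1 2 2 1
  · rw [fcoef_apply k hm, iCross_apply_one]; exact comp 2 0 0 2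
  · rw [fcoef_apply k hm, iCross_apply_two]; exact comp 0 1 1 0

theorem eq_zero_of_forall_norm_le {v : C3} {C : ℝ} (h : ∀ δ : ℝ, 0 < δ → ‖v‖ ≤ C * δ) :
    v = 0 := by
  have ht : Filter.Tendsto (fun δ : ℝ => C * δ) (nhdsWithin 0 (Set.Ioi 0)) (nhds 0) := by
    have : Filter.Tendsto (fun δ : ℝ => C * δ) (nhds 0) (nhds (C * 0)) :=
      (continuous_const.mul continuous_id).tendsto 0
    rw [mul_zero] at this
    exact this.mono_left nhdsWithin_le_nhds
  exact norm_le_zero_iff.mp (ge_of_tendsto ht (eventually_nhdsWithin_of_forall h))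

theorem norm_fcoef_le_of_eLpNorm [IsProbabilityMeasure (onCell μ)] (k : Fin 3 → ℤ) {f : R3 → C3}
    (hf : MemLp f 2 (onCell μ)) {δ : ℝ} (hδ : 0 ≤ δ)
    (h : eLpNorm f 2 (onCell μ) ≤ ENNReal.ofReal δ) : ‖fcoef μ k f‖ ≤ δ :=
  (ENNReal.ofReal_le_ofReal_iff hδ).mp ((norm_fcoef_le k hf).trans h)

/-- A matrix function all of whose values have the same ellipticity bounds. -/
structure IsEllipticField (α β : ℝ) (A : R3 → M3) : Prop where
  measurable : ∀ i j, Measurable fun x => A x i j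
  pos : 0 < α
  bounds : ∀ x, MatBounds α β (A x)

namespace IsEllipticField

variable {α β : ℝ} {A : R3 → M3}

theorem sqrt (h : IsEllipticField α β A) : IsBddMeas (fun x => sqrtM (A x)) (√β) :=
  ⟨measurable_sqrtM_apply h.measurable fun x => (h.bounds x).posSemidef h.pos,
    fun x => (h.bounds x).norm_act_sqrt_le h.pos⟩

theorem sqrt_inv (h : IsEllipticField α β A) : IsBddMeas (fun x => (sqrtM (A x))⁻¹) (√α)⁻¹ :=
  ⟨measurable_inv_apply h.sqrt.measurable, fun x => (h.bounds x).norm_act_sqrt_inv_le h.pos⟩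

theorem inv (h : IsEllipticField α β A) : IsBddMeas (fun x => (A x)⁻¹) α⁻¹ :=
  ⟨measurable_inv_apply h.measurable, fun x => (h.bounds x).norm_act_inv_le h.pos⟩

theorem self (h : IsEllipticField α β A) (hβ : 0 ≤ β) : IsBddMeas A β :=
  ⟨h.measurable, fun x => (h.bounds x).norm_act_le h.pos hβ⟩

end IsEllipticField

variable {α β : ℝ} {A : R3 → M3}

/-- The identity holds for smooth fields by `fcoef_curl`. For a fixed `k` both sides are continuous
in `L²`, so it survives the closure defining the Sobolev space. -/
theorem fcoef_of_memHCurl [IsProbabilityMeasure (onCell μ)] (hμ : IsAdmissibleMeasure μ)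
    (hA : IsEllipticField α β A) {κ : R3} {u v : R3 → C3} (h : MemHCurl μ A κ u v)
    (k : Fin 3 → ℤ) :
    fcoef μ k (fun x => expo (-κ) x • v x) =
      iCross (freq k + κ) (fcoef μ k fun x => expo (-κ) x • act (sqrtM (A x)) (u x)) := by
  obtain ⟨hu, hv, happ⟩ := h
  set V := fun x => expo (-κ) x • v x
  set F := fun x => expo (-κ) x • act (sqrtM (A x)) (u x)
  have hV : MemLp V 2 (onCell μ) := memLp_expo_smul _ hv
  have hF : MemLp F 2 (onCell μ) := memLp_expo_smul _ (hA.sqrt.memLp hu)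
  rw [← sub_eq_zero]
  refine eq_zero_of_forall_norm_le (C := 1 + ‖freq k + κ‖ * √β) fun δ hδ => ?_
  obtain ⟨φ, hs, hp, h1, h2⟩ := happ (ENNReal.ofReal δ) (ENNReal.ofReal_pos.mpr hδ)
  set Φ := fun x => act (sqrtM (A x)) (φ x) with hΦ
  set Z := fun x => expo (-κ) x • curl (fun y => expo κ y • Φ y) x with hZ
  have hΦm : MemLp Φ 2 (onCell μ) := memLp_of_continuous hs.continuous 2
  have hZm : MemLp Z 2 (onCell μ) := memLp_expo_smul _
    (memLp_of_continuous (continuous_curl ((contDiff_expo κ).smul hs)) 2)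
  have e1 : ‖fcoef μ k V - fcoef μ k Z‖ ≤ δ := by
    rw [← fcoef_sub k hV hZm]
    refine norm_fcoef_le_of_eLpNorm k (hV.sub hZm) hδ.le (le_trans (le_of_eq ?_) h2.le)
    refine eLpNorm_congr_norm_ae (Filter.Eventually.of_forall fun x => ?_)
    rw [Pi.sub_apply]
    simp only [V, hZ]
    rw [← smul_sub, norm_smul, norm_expo, one_mul]
  have e2 : ‖fcoef μ k F - fcoef μ k Φ‖ ≤ √β * δ := by
    rw [← fcoef_sub k hF hΦm]
    refine norm_fcoef_le_of_eLpNorm k (hF.sub hΦm) (by positivity) ?_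
    rw [ENNReal.ofReal_mul (Real.sqrt_nonneg β)]
    refine (eLpNorm_le_mul_eLpNorm_of_ae_le_mul (g := fun x => u x - expo κ x • φ x) (c := √β)
      (Filter.Eventually.of_forall fun x => ?_) 2).trans (mul_le_mul_right h1.le _)
    have : F x - Φ x = expo (-κ) x • act (sqrtM (A x)) (u x - expo κ x • φ x) := by
      simp only [F, hΦ, act_sub, act_smul, smul_sub, smul_smul, expo_neg_mul_expo, one_smul]
    rw [Pi.sub_apply, this, norm_smul, norm_expo, one_mul]
    exact hA.sqrt.bound x _
  have e3 : fcoef μ k V - iCross (freq k + κ) (fcoef μ k F) =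
      (fcoef μ k V - fcoef μ k Z) - iCross (freq k + κ) (fcoef μ k F - fcoef μ k Φ) := by
    rw [iCross_sub, hZ, fcoef_curl hμ k κ hs hp]
    abel
  rw [e3]
  calc _ ≤ δ + ‖freq k + κ‖ * (√β * δ) := (norm_sub_le _ _).trans
        (add_le_add e1 ((norm_iCross_le _ _).trans (by gcongr)))
    _ = _ := by ring

theorem curl_expo_smul (ξ : R3) (c : C3) (x : R3) :
    curl (fun y => expo ξ y • c) x = expo ξ x • iCross ξ c := by
  have key : ∀ i j, partialDeriv j (fun y => (expo ξ y • c) i) x =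
      Complex.I * ξ j * (expo ξ x * c i) := fun i j => by
    have h := partialDeriv_expo_mul ξ j (f := fun _ => c i) (x := x)
      (differentiableAt_const _)
    have h0 : partialDeriv j (fun _ : R3 => c i) x = 0 := by simp [partialDeriv]
    rw [h0] at h
    refine h.trans ?_
    ring
  apply ext_C3
  · rw [PiLp.smul_apply, iCross_apply_zero]
    refine (congrArg₂ (· - ·) (key 2 1) (key 1 2)).trans ?_
    rw [smul_eq_mul]; ring
  · rw [PiLp.smul_apply, iCross_apply_one]
    refine (congrArg₂ (· - ·) (key 0 2) (key 2 0)).trans ?_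
    rw [smul_eq_mul]; ring
  · rw [PiLp.smul_apply, iCross_apply_two]
    refine (congrArg₂ (· - ·) (key 1 0) (key 0 1)).trans ?_
    rw [smul_eq_mul]; ring

/-- These are the test fields that extract one Fourier coefficient from a weak equation. They lie in
the generating set itself, so the approximation error is zero. -/
theorem memHCurl_expo [IsProbabilityMeasure (onCell μ)] (hA : IsEllipticField α β A)
    (κ : R3) (k : Fin 3 → ℤ) (c : C3) :
    MemHCurl μ A κ (fun x => expo κ x • act (sqrtM (A x))⁻¹ (expo (freq k) x • c))
      (fun x => expo κ x • expo (freq k) x • iCross (freq k + κ) c) := by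
  have hc : MemLp (fun x => expo (freq k) x • c) 2 (onCell μ) := memLp_expo_smul _ (memLp_const c)
  refine ⟨memLp_expo_smul _ (hA.sqrt_inv.memLp hc),
    memLp_expo_smul _ (memLp_expo_smul _ (memLp_const _)), fun δ hδ =>
    ⟨fun x => act (sqrtM (A x))⁻¹ (expo (freq k) x • c), ?_, ?_, ?_, ?_⟩⟩
  · simp only [(hA.bounds _).act_sqrt_act_sqrt_inv hA.pos]
    exact (contDiff_expo _).smul contDiff_const
  · simp only [(hA.bounds _).act_sqrt_act_sqrt_inv hA.pos]
    intro j x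
    simp only [isPeriodic_expo_freq k j x]
  · simp only [sub_self, eLpNorm_zero']
    exact hδ
  · simp only [(hA.bounds _).act_sqrt_act_sqrt_inv hA.pos]
    have e : (fun y => expo κ y • expo (freq k) y • c) = fun y => expo (freq k + κ) y • c := by
      funext y
      rw [smul_smul, ← expo_add, add_comm]
    have e' : ∀ x, expo κ x • expo (freq k) x • iCross (freq k + κ) c -
        curl (fun y => expo κ y • expo (freq k) y • c) x = 0 := fun x => by
      rw [e, curl_expo_smul, smul_smul, ← expo_add, add_comm κ, sub_self]
    simp only [e', eLpNorm_zero']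
    exact hδ

theorem fcoef_gradient [IsProbabilityMeasure (onCell μ)] (hμ : IsAdmissibleMeasure μ)
    (k : Fin 3 → ℤ) {f : R3 → ℂ} (hf : ContDiff ℝ ∞ f) (hp : IsPeriodic f) :
    fcoef μ k (gradient f) = (∫ x, expo (-freq k) x * f x ∂(onCell μ)) • iVec (freq k) := by
  ext j
  rw [fcoef_apply k (memLp_of_continuous (continuous_gradient hf) 2)]
  have h := integral_expo_partialDeriv hμ k 0 j hf hp
  simp only [expo_zero, one_mul, add_zero] at h
  refine h.trans ?_
  simp [iVec]
  ring

/-- Again a closure argument from the smooth case. Being parallel to the frequency is what later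
makes gradients curl-free. -/
theorem fcoef_of_memH1Zero [IsProbabilityMeasure (onCell μ)] (hμ : IsAdmissibleMeasure μ)
    {ψ : R3 → ℂ} {g : R3 → C3} (h : MemH1Zero μ ψ g) (k : Fin 3 → ℤ) :
    fcoef μ k g = (∫ x, expo (-freq k) x * ψ x ∂(onCell μ)) • iVec (freq k) := by
  obtain ⟨hψ, hg, happ, -⟩ := h
  rw [← sub_eq_zero]
  refine eq_zero_of_forall_norm_le (C := 1 + ‖iVec (freq k)‖) fun δ hδ => ?_
  obtain ⟨φ, hs, hp, h1, h2⟩ := happ (ENNReal.ofReal δ) (ENNReal.ofReal_pos.mpr hδ)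
  have hφm : MemLp φ 2 (onCell μ) := memLp_of_continuous hs.continuous 2
  have hGm : MemLp (gradient φ) 2 (onCell μ) := memLp_of_continuous (continuous_gradient hs) 2
  have e1 : ‖fcoef μ k g - fcoef μ k (gradient φ)‖ ≤ δ := by
    rw [← fcoef_sub k hg hGm]
    exact norm_fcoef_le_of_eLpNorm k (hg.sub hGm) hδ.le h2.le
  have hsub := hψ.sub hφm
  have e2 : ‖(∫ x, expo (-freq k) x * ψ x ∂(onCell μ)) -
      ∫ x, expo (-freq k) x * φ x ∂(onCell μ)‖ ≤ δ := by
    rw [← integral_sub (integrable_expo_mul _ hψ) (integrable_expo_mul _ hφm)]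
    have h3 : ENNReal.ofReal ‖∫ x, (expo (-freq k) x * ψ x - expo (-freq k) x * φ x) ∂(onCell μ)‖ ≤
        ENNReal.ofReal δ := by
      rw [ofReal_norm]
      refine (enorm_integral_le_lintegral_enorm _).trans ?_
      rw [← eLpNorm_one_eq_lintegral_enorm]
      refine (eLpNorm_congr_norm_ae (g := fun x => ψ x - φ x)
        (Filter.Eventually.of_forall fun x => ?_)).trans_le
        ((eLpNorm_le_eLpNorm_of_exponent_le one_le_two hsub.1).trans h1.le)
      rw [← mul_sub, norm_mul, norm_expo, one_mul]
    exact (ENNReal.ofReal_le_ofReal_iff hδ.le).mp h3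
  have e3 : fcoef μ k g - (∫ x, expo (-freq k) x * ψ x ∂(onCell μ)) • iVec (freq k) =
      (fcoef μ k g - fcoef μ k (gradient φ)) - ((∫ x, expo (-freq k) x * ψ x ∂(onCell μ)) -
        ∫ x, expo (-freq k) x * φ x ∂(onCell μ)) • iVec (freq k) := by
    rw [fcoef_gradient hμ k hs hp, sub_smul]
    abel
  rw [e3]
  calc _ ≤ δ + δ * ‖iVec (freq k)‖ := (norm_sub_le _ _).trans
        (add_le_add e1 (by rw [norm_smul]; gcongr))
    _ = _ := by ring

theorem gradient_expo_mul (κ η : R3) (x : R3) :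
    gradient (fun y => expo κ y * expo η y) x = expo (η + κ) x • iVec (η + κ) := by
  have e : (fun y => expo κ y * expo η y) = expo (η + κ) := by
    funext y; rw [← expo_add, add_comm]
  rw [e]
  ext j
  change partialDeriv j (expo (η + κ)) x = _
  rw [partialDeriv_expo]
  simp [iVec]
  ring

theorem realDot_fcoef_of_isQuasiDivFree [IsProbabilityMeasure (onCell μ)] {κ : R3} {G : R3 → C3}
    (hG : MemLp G 2 (onCell μ)) (h : IsQuasiDivFree μ κ G) (k : Fin 3 → ℤ) :
    realDot (freq k + κ) (fcoef μ k G) = 0 := by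
  apply realDot_eq_zero_of_inner_iVec
  have h1 := h _ (contDiff_expo (freq k)) (isPeriodic_expo_freq k)
  rw [← integral_inner_expo k _ hG, ← h1]
  refine integral_congr_ae (Filter.Eventually.of_forall fun x => ?_)
  simp only [gradient_expo_mul, dot_conjVec]
  rw [expo_add, mul_comm, mul_smul, inner_expo_smul κ, smul_smul, expo_neg_mul_expo, one_smul]

/-- The periodic part `∇ψ + iκψ` of the quasi-periodic gradient. -/
def twistedGrad (κ : R3) (ψ : R3 → ℂ) (g : R3 → C3) (x : R3) : C3 := g x + ψ x • iVec κ

theorem memLp_twistedGrad (κ : R3) {ψ : R3 → ℂ} {g : R3 → C3} (h : MemH1Zero μ ψ g) :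
    MemLp (twistedGrad κ ψ g) 2 (onCell μ) := by
  refine h.2.1.add ?_
  have : MemLp (fun x => iVec κ) ⊤ (onCell μ) := memLp_top_const _
  exact this.smul h.1

theorem fcoef_twistedGrad [IsProbabilityMeasure (onCell μ)] (hμ : IsAdmissibleMeasure μ) (κ : R3)
    {ψ : R3 → ℂ} {g : R3 → C3} (h : MemH1Zero μ ψ g) (k : Fin 3 → ℤ) :
    fcoef μ k (twistedGrad κ ψ g) =
      (∫ x, expo (-freq k) x * ψ x ∂(onCell μ)) • iVec (freq k + κ) := by
  have e : ∀ x, expo (-freq k) x • twistedGrad κ ψ g x =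
      expo (-freq k) x • g x + (expo (-freq k) x * ψ x) • iVec κ := fun x => by
    rw [twistedGrad, smul_add, smul_smul]
  simp only [fcoef, e]
  rw [integral_add (integrable_expo_smul _ h.2.1) ((integrable_expo_mul _ h.1).smul_const _),
    integral_smul_const, iVec_add, smul_add, ← fcoef_of_memH1Zero hμ h k]
  rfl

theorem fcoef_twistedGrad_zero [IsProbabilityMeasure (onCell μ)] (hμ : IsAdmissibleMeasure μ)
    (κ : R3) {ψ : R3 → ℂ} {g : R3 → C3} (h : MemH1Zero μ ψ g) :
    fcoef μ 0 (twistedGrad κ ψ g) = 0 := by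
  rw [fcoef_twistedGrad hμ κ h]
  have : ∫ x, expo (-freq 0) x * ψ x ∂(onCell μ) = 0 := by
    simp only [freq_zero, neg_zero, expo_zero, one_mul]
    exact h.2.2.2
  rw [this, zero_smul]

/-- The exponential of frequency `2πk` is an allowed test function because it has zero mean, which
is why `k = 0` is excluded. -/
theorem realDot_fcoef_of_isGradCellSol [IsProbabilityMeasure (onCell μ)]
    (hμ : IsAdmissibleMeasure μ) (hA : IsEllipticField α β A) {κ : R3} {c : C3} {ψ : R3 → ℂ}
    {g : R3 → C3} (h : IsGradCellSol μ A κ c ψ g) {k : Fin 3 → ℤ} (hk : k ≠ 0) :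
    realDot (freq k + κ) (fcoef μ k fun x => act (A x)⁻¹ (twistedGrad κ ψ g x + c)) = 0 := by
  obtain ⟨hmem, hw⟩ := h
  have h1 := hw _ (contDiff_expo (freq k)) (isPeriodic_expo_freq k) (integral_expo_freq hμ hk)
  have hm1 : MemLp (fun x => act (A x)⁻¹ (twistedGrad κ ψ g x)) 2 (onCell μ) :=
    hA.inv.memLp (memLp_twistedGrad κ hmem)
  have hm2 : MemLp (fun x => act (A x)⁻¹ c) 2 (onCell μ) := hA.inv.memLp (memLp_const c)
  have e : ∀ x (v : C3), dot (act (A x)⁻¹ (expo κ x • v))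
      (conjVec (gradient (fun y => expo κ y * expo (freq k) y) x)) =
      inner ℂ (expo (freq k) x • iVec (freq k + κ)) (act (A x)⁻¹ v) := fun x v => by
    rw [gradient_expo_mul, dot_conjVec, act_smul, expo_add, mul_comm, mul_smul, inner_expo_smul κ,
      smul_smul, expo_neg_mul_expo, one_smul]
  simp only [quasiGrad, e] at h1
  have h2 : ∫ x, inner ℂ (expo (freq k) x • iVec (freq k + κ))
      (act (A x)⁻¹ (twistedGrad κ ψ g x)) ∂(onCell μ) =
      -∫ x, inner ℂ (expo (freq k) x • iVec (freq k + κ)) (act (A x)⁻¹ c) ∂(onCell μ) := h1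
  rw [integral_inner_expo k _ hm1, integral_inner_expo k _ hm2] at h2
  apply realDot_eq_zero_of_inner_iVec
  have h3 : fcoef μ k (fun x => act (A x)⁻¹ (twistedGrad κ ψ g x + c)) =
      fcoef μ k (fun x => act (A x)⁻¹ (twistedGrad κ ψ g x)) +
        fcoef μ k (fun x => act (A x)⁻¹ c) := by
    simp only [fcoef, act_add, smul_add]
    exact integral_add (integrable_expo_smul _ hm1) (integrable_expo_smul _ hm2)
  rw [h3, inner_add_right, h2, neg_add_cancel]

end Weak

/-! ### The cell problems and the Maxwell problem in Fourier coefficients -/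

section Problems

variable {μ : Measure R3} {α β : ℝ} {A : R3 → M3}

theorem inner_act_sqrt_inv (P : M3) (u v : C3) :
    inner ℂ (act (sqrtM P)⁻¹ u) v = inner ℂ u (act (sqrtM P)⁻¹ v) :=
  inner_act_of_isSymm (by
    rw [Matrix.IsSymm, Matrix.transpose_nonsing_inv, MatBounds.sqrt_isSymm P]) u v

theorem fcoef_of_memHCurl_zero [IsProbabilityMeasure (onCell μ)] (hμ : IsAdmissibleMeasure μ)
    (hA : IsEllipticField α β A) {u v : R3 → C3} (h : MemHCurl μ A 0 u v) (k : Fin 3 → ℤ) :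
    fcoef μ k v = iCross (freq k) (fcoef μ k fun x => act (sqrtM (A x)) (u x)) := by
  have := fcoef_of_memHCurl hμ hA h k
  simpa only [neg_zero, expo_zero, one_smul, add_zero] using this

theorem ae_eq_of_fcoef [IsProbabilityMeasure (onCell μ)] (hμ : IsAdmissibleMeasure μ)
    {f g : R3 → C3} (hf : MemLp f 2 (onCell μ)) (hg : MemLp g 2 (onCell μ))
    (h : ∀ k, fcoef μ k f = fcoef μ k g) : f =ᵐ[onCell μ] g := by
  rw [← MemLp.toLp_eq_toLp_iff hf hg]
  apply (fourierEquiv μ hμ).injective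
  ext1
  funext k
  change co (fourierEquiv μ hμ) k _ = co (fourierEquiv μ hμ) k _
  rw [co_toLp, co_toLp, h]

theorem iCross_fcoef_const [IsProbabilityMeasure (onCell μ)] (hμ : IsAdmissibleMeasure μ)
    (k : Fin 3 → ℤ) (c : C3) : iCross (freq k) (fcoef μ k fun _ => c) = 0 := by
  by_cases hk : k = 0
  · rw [hk, freq_zero, iCross_zero_left]
  · have h := integral_expo_freq hμ (neg_ne_zero.mpr hk)
    simp only [fcoef, ← freq_neg]
    rw [integral_smul_const, h, zero_smul, iCross_zero]

/-- The columns of `curl (A^{1/2} N)` do not depend on the gradient part of the corrector `N`. -/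
theorem IsCorrector.curl_ae_eq [IsProbabilityMeasure (onCell μ)] (hμ : IsAdmissibleMeasure μ)
    (hA : IsEllipticField α β A) {At : R3 → M3} {Ntilde Wtilde N W : Fin 3 → R3 → C3}
    (ht : IsCurlCellSol μ A At Ntilde Wtilde) (h : IsCorrector μ A Ntilde N W) (j : Fin 3) :
    W j =ᵐ[onCell μ] Wtilde j := by
  obtain ⟨a, Ψ, g, hj⟩ := h
  obtain ⟨hg, hm, hN⟩ := hj j
  have hg2 : MemLp (g j) 2 (onCell μ) := hg.1.2.1
  have hs : MemLp (fun x => act (sqrtM (A x)) (N j x)) 2 (onCell μ) := hA.sqrt.memLp hm.1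
  have hst : MemLp (fun x => act (sqrtM (A x)) (Ntilde j x)) 2 (onCell μ) :=
    hA.sqrt.memLp (ht.mem j).1
  refine ae_eq_of_fcoef hμ hm.2.1 (ht.mem j).2.1 fun k => ?_
  rw [fcoef_of_memHCurl_zero hμ hA hm, fcoef_of_memHCurl_zero hμ hA (ht.mem j), ← sub_eq_zero,
    ← iCross_sub, ← fcoef_sub k hs hst]
  -- The two correctors differ by a gradient plus a constant: the gradient has coefficients parallel
  -- to the frequency, and the constant lives at frequency zero, so neither contributes a curl.
  have e : (fun x => act (sqrtM (A x)) (N j x) - act (sqrtM (A x)) (Ntilde j x)) =ᵐ[onCell μ]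
      fun x => g j x + a j := by
    filter_upwards [hN] with x hx
    rw [hx, act_add, (hA.bounds x).act_sqrt_act_sqrt_inv hA.pos, add_sub_cancel_left]
  have e' : fcoef μ k (fun x => g j x + a j) = fcoef μ k (g j) + fcoef μ k fun _ => a j := by
    simp only [fcoef, smul_add]
    exact integral_add (integrable_expo_smul _ hg2) (integrable_expo_smul _ (memLp_const _))
  rw [fcoef_congr k e, e', iCross_add, iCross_fcoef_const hμ, fcoef_of_memH1Zero hμ hg.1,
    iCross_iVec, add_zero]

theorem iCross_fcoef_of_isCurlCellSol [IsProbabilityMeasure (onCell μ)]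
    (hμ : IsAdmissibleMeasure μ) (hA : IsEllipticField α β A) {At : R3 → M3} {b : ℝ}
    (hAt : IsBddMeas At b) {N W : Fin 3 → R3 → C3} (h : IsCurlCellSol μ A At N W)
    {k : Fin 3 → ℤ} (hk : k ≠ 0) (j : Fin 3) :
    iCross (freq k) (fcoef μ k fun x => act (At x) (W j x + basisVec j)) = 0 := by
  refine ext_inner_left ℂ fun c => ?_
  -- The factor `A^{-1/2}` in the test field cancels the `A^{1/2}` in the mean-zero constraint,
  -- which then holds since `k ≠ 0`.
  have hmem := memHCurl_expo (μ := μ) hA 0 k c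
  simp only [expo_zero, one_smul, add_zero] at hmem
  have h1 := h.weak j _ _ hmem (by
    simp only [(hA.bounds _).act_sqrt_act_sqrt_inv hA.pos]
    rw [integral_smul_const, integral_expo_freq hμ hk, zero_smul])
  have hm1 : MemLp (fun x => act (At x) (W j x)) 2 (onCell μ) := hAt.memLp (h.mem j).2.1
  have hm2 : MemLp (fun x => act (At x) (basisVec j)) 2 (onCell μ) := hAt.memLp (memLp_const _)
  simp only [dot_conjVec] at h1
  rw [integral_inner_expo k _ hm1, integral_inner_expo k _ hm2] at h1
  have h3 : fcoef μ k (fun x => act (At x) (W j x + basisVec j)) =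
      fcoef μ k (fun x => act (At x) (W j x)) + fcoef μ k (fun x => act (At x) (basisVec j)) := by
    simp only [fcoef, act_add, smul_add]
    exact integral_add (integrable_expo_smul _ hm1) (integrable_expo_smul _ hm2)
  rw [← inner_iCross_left, h3, inner_add_right, h1, neg_add_cancel, inner_zero_right]

/-- The field `ε⁻¹ e̅_κ curl (e_κ A^{1/2} D)`. -/
def scaledCurl (ε : ℝ) (κ : R3) (V : R3 → C3) (x : R3) : C3 :=
  ((ε⁻¹ : ℝ) : ℂ) • expo (-κ) x • V x

theorem memLp_of_expo_smul {κ : R3} {D : R3 → C3}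
    (h : MemLp (fun x => expo κ x • D x) 2 (onCell μ)) : MemLp D 2 (onCell μ) := by
  have := memLp_expo_smul (-κ) h
  simpa only [smul_smul, expo_neg_mul_expo, one_smul] using this

theorem memLp_scaledCurl (ε : ℝ) (κ : R3) {V : R3 → C3} (hV : MemLp V 2 (onCell μ)) :
    MemLp (scaledCurl ε κ V) 2 (onCell μ) :=
  (memLp_expo_smul (-κ) hV).const_smul (((ε⁻¹ : ℝ) : ℂ))

theorem fcoef_scaledCurl (ε : ℝ) (κ : R3) (V : R3 → C3) (k : Fin 3 → ℤ) :
    fcoef μ k (scaledCurl ε κ V) =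
      ((ε⁻¹ : ℝ) : ℂ) • fcoef μ k (fun x => expo (-κ) x • V x) := by
  simp only [fcoef, scaledCurl]
  rw [← integral_smul]
  refine integral_congr_ae (Filter.Eventually.of_forall fun x => ?_)
  exact smul_comm _ _ _

theorem IsMaxwellSol.fcoef_curl [IsProbabilityMeasure (onCell μ)] (hμ : IsAdmissibleMeasure μ)
    (hA : IsEllipticField α β A) {At : R3 → M3} {ε : ℝ} {θ : R3} {G D V : R3 → C3}
    (h : IsMaxwellSol μ A At ε θ G D V) (k : Fin 3 → ℤ) :
    fcoef μ k (scaledCurl ε (ε • θ) V) = ((ε⁻¹ : ℝ) : ℂ) •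
      iCross (freq k + ε • θ) (fcoef μ k fun x => act (sqrtM (A x)) (D x)) := by
  rw [fcoef_scaledCurl, fcoef_of_memHCurl hμ hA h.1]
  simp only [act_smul, smul_smul, expo_neg_mul_expo, one_smul]

/-- Testing with `A^{-1/2} e^{2πik·x} c` removes `A^{1/2}` from the source and turns `D` into `A⁻¹
(A^{1/2} D)`, so `F = A^{1/2} D` becomes the unknown. -/
theorem IsMaxwellSol.fcoef_eq [IsProbabilityMeasure (onCell μ)]
    (hA : IsEllipticField α β A) {At : R3 → M3} {b : ℝ} (hAt : IsBddMeas At b) {ε : ℝ} (hε : 0 < ε)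
    {θ : R3} {G D V : R3 → C3} (hG : MemLp G 2 (onCell μ))
    (h : IsMaxwellSol μ A At ε θ G D V) (k : Fin 3 → ℤ) :
    ((ε⁻¹ : ℝ) : ℂ) • iCross (freq k + ε • θ)
        (fcoef μ k fun x => act (At x) (scaledCurl ε (ε • θ) V x)) +
      fcoef μ k (fun x => act (A x)⁻¹ (act (sqrtM (A x)) (D x))) = -fcoef μ k G := by
  refine ext_inner_left ℂ fun c => ?_
  have hD : MemLp D 2 (onCell μ) := memLp_of_expo_smul h.1.1
  have hX := memLp_scaledCurl ε (ε • θ) h.1.2.1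
  have h1 := h.2 _ _ (memHCurl_expo (μ := μ) hA (ε • θ) k c)
  -- Expressing `V` through the scaled curl releases one factor `ε`, which reduces `ε⁻²` to `ε⁻¹`.
  have e1 : ∀ x, dot (act (At x) (V x)) (conjVec (expo (ε • θ) x • expo (freq k) x •
      iCross (freq k + ε • θ) c)) = (ε : ℂ) * inner ℂ (expo (freq k) x •
        iCross (freq k + ε • θ) c) (act (At x) (scaledCurl ε (ε • θ) V x)) := fun x => by
    have hεc : (ε : ℂ) * ((ε⁻¹ : ℝ) : ℂ) = 1 := by
      rw [Complex.ofReal_inv, mul_inv_cancel₀ (by exact_mod_cast hε.ne')]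
    rw [dot_conjVec, inner_expo_smul, scaledCurl, act_smul, act_smul,
      inner_smul_right _ _ ((ε⁻¹ : ℝ) : ℂ), ← mul_assoc, hεc, one_mul]
  have e2 : ∀ x, dot (D x) (conjVec (act (sqrtM (A x))⁻¹ (expo (freq k) x • c))) =
      inner ℂ (expo (freq k) x • c) (act (A x)⁻¹ (act (sqrtM (A x)) (D x))) := fun x => by
    rw [dot_conjVec, inner_act_sqrt_inv, (hA.bounds x).act_inv hA.pos,
      (hA.bounds x).act_sqrt_inv_act_sqrt hA.pos]
  have e3 : ∀ x, dot (act (sqrtM (A x)) (G x))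
      (conjVec (act (sqrtM (A x))⁻¹ (expo (freq k) x • c))) =
      inner ℂ (expo (freq k) x • c) (G x) := fun x => by
    rw [dot_conjVec, inner_act_sqrt_inv, (hA.bounds x).act_sqrt_inv_act_sqrt hA.pos]
  simp only [e1, e2, e3] at h1
  rw [integral_const_mul, integral_inner_expo k _ (hAt.memLp hX),
    integral_inner_expo k c (hA.inv.memLp (hA.sqrt.memLp hD)), integral_inner_expo k c hG] at h1
  rw [inner_add_right, inner_smul_right, inner_neg_right, ← h1, ← inner_iCross_left]
  congr 1
  rw [← mul_assoc]
  congr 1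
  have : (ε : ℂ) ≠ 0 := by exact_mod_cast hε.ne'
  push_cast
  field_simp

theorem toLp_comb {W : Fin 3 → R3 → C3} (hW : ∀ j, MemLp (W j) 2 (onCell μ)) (s : C3) :
    (comb (fun j => (hW j).toLp) s : Lp C3 2 (onCell μ)) =ᵐ[onCell μ] fun x => ∑ j, s j • W j x := by
  have h1 := Lp.coeFn_add (s 0 • (hW 0).toLp + s 1 • (hW 1).toLp) (s 2 • (hW 2).toLp)
  have h2 := Lp.coeFn_add (s 0 • (hW 0).toLp) (s 1 • (hW 1).toLp)
  have e : comb (fun j => (hW j).toLp) s =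
      s 0 • (hW 0).toLp + s 1 • (hW 1).toLp + s 2 • (hW 2).toLp := by
    simp only [comb, Fin.sum_univ_three]
  rw [e]
  filter_upwards [h1, h2, Lp.coeFn_smul (s 0) (hW 0).toLp, Lp.coeFn_smul (s 1) (hW 1).toLp,
    Lp.coeFn_smul (s 2) (hW 2).toLp, (hW 0).coeFn_toLp, (hW 1).coeFn_toLp,
    (hW 2).coeFn_toLp] with x a1 a2 b0 b1 b2 c0 c1 c2
  rw [a1, Pi.add_apply, a2, Pi.add_apply, b0, b1, b2, Pi.smul_apply, Pi.smul_apply, Pi.smul_apply,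
    c0, c1, c2, Fin.sum_univ_three]

theorem mulOp_add_cst [IsProbabilityMeasure (onCell μ)] (hμ : IsAdmissibleMeasure μ)
    {M : R3 → M3} {b : ℝ} (hM : IsBddMeas M b) {f : R3 → C3} (hf : MemLp f 2 (onCell μ)) (c : C3) :
    mulOp μ hM (hf.toLp + cst (fourierEquiv μ hμ) c) =
      (hM.memLp (hf.add (memLp_const c))).toLp := by
  rw [cst_eq, ← MemLp.toLp_add, mulOp_toLp]

theorem co_mulOp_add_cst [IsProbabilityMeasure (onCell μ)] (hμ : IsAdmissibleMeasure μ)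
    {M : R3 → M3} {b : ℝ} (hM : IsBddMeas M b) {f : R3 → C3} (hf : MemLp f 2 (onCell μ)) (c : C3)
    (k : Fin 3 → ℤ) :
    co (fourierEquiv μ hμ) k (mulOp μ hM (hf.toLp + cst (fourierEquiv μ hμ) c)) =
      fcoef μ k fun x => act (M x) (f x + c) := by
  rw [mulOp_add_cst, co_toLp]
  rfl

/-- The estimate for the magnetic induction, with the constant of the abstract estimate. -/
theorem eLpNorm_induction_le [IsProbabilityMeasure (onCell μ)] (hμ : IsAdmissibleMeasure μ)
    (hA : IsEllipticField α β A) {At : R3 → M3} {b c M : ℝ} (hAt : IsBddMeas At b)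
    (hc : 0 < c) (hM : 0 ≤ M) (hS : IsElliptic c M (mulOp μ hA.inv))
    (hT : IsElliptic c M (mulOp μ hAt)) {ε : ℝ} (hε : 0 < ε) {θ : R3}
    (hθ : ∀ j, ε * θ j ∈ Set.Ico (-Real.pi) Real.pi)
    {Ntilde Wtilde : Fin 3 → R3 → C3} (hN : IsCurlCellSol μ A At Ntilde Wtilde)
    {Ψ : Fin 3 → R3 → ℂ} {g : Fin 3 → R3 → C3} (hΨ : IsPsi μ A (ε • θ) Ψ g)
    {G : R3 → C3} (hG : MemLp G 2 (onCell μ)) (hGdiv : IsQuasiDivFree μ (ε • θ) G)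
    {D V : R3 → C3} (hD : IsMaxwellSol μ A At ε θ G D V) {d : C3}
    (hd : d = dVec (hatAHom μ A (ε • θ) Ψ g) (tildeAHom μ At Wtilde) θ
      (∫ x, G x ∂(onCell μ))) :
    eLpNorm (fun x => scaledCurl ε (ε • θ) V x - curlPlusId Wtilde (iCross θ d) x) 2 (onCell μ) ≤
      ENNReal.ofReal (coreConst c M * ε * (eLpNorm G 2 (onCell μ)).toReal) := by
  set U := fourierEquiv μ hμ
  set s := iCross θ d with hs
  have hW : ∀ j, MemLp (Wtilde j) 2 (onCell μ) := fun j => (hN.mem j).2.1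
  have hg : ∀ j, MemLp (twistedGrad (ε • θ) (Ψ j) (g j)) 2 (onCell μ) := fun j =>
    memLp_twistedGrad _ (hΨ j).1
  have hDm : MemLp D 2 (onCell μ) := memLp_of_expo_smul hD.1.1
  have hF := hA.sqrt.memLp hDm
  have hX := memLp_scaledCurl ε (ε • θ) hD.1.2.1
  have hξ : ∀ k, k ≠ 0 → 1 ≤ ‖freq k + ε • θ‖ := fun k hk => one_le_norm_freq_add hθ hk
  have hWc : ∀ k j, co U k (hW j).toLp =
      iCross (freq k) (fcoef μ k fun x => act (sqrtM (A x)) (Ntilde j x)) := fun k j => by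
    rw [co_toLp, fcoef_of_memHCurl_zero hμ hA (hN.mem j)]
  have hhat : effMatrix U (mulOp μ hA.inv) (fun j => (hg j).toLp) = hatAHom μ A (ε • θ) Ψ g := by
    ext i j
    simp only [effMatrix, hatAHom, Matrix.of_apply]
    rw [co_mulOp_add_cst, fcoef_zero_index]
    have e : ∀ x, (starRingEnd ℂ) (expo (ε • θ) x) • quasiGrad (ε • θ) (Ψ j) (g j) x =
        twistedGrad (ε • θ) (Ψ j) (g j) x := fun x => by
      rw [quasiGrad, conj_expo, smul_smul, expo_neg_mul_expo, one_smul, twistedGrad]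
    simp only [e]
  have htil : effMatrix U (mulOp μ hAt) (fun j => (hW j).toLp) = tildeAHom μ At Wtilde := by
    ext i j
    simp only [effMatrix, tildeAHom, Matrix.of_apply]
    rw [co_mulOp_add_cst, fcoef_zero_index]
  have hG0 : co U 0 hG.toLp = ∫ x, G x ∂(onCell μ) := by rw [co_toLp, fcoef_zero_index]
  rw [← hhat, ← htil, ← hG0] at hd
  have main := core_estimate_columns U hc hM hS hT freq_zero (fun k hk => one_le_norm_freq hk) hε
    hξ (W := fun j => (hW j).toLp) (g := fun j => (hg j).toLp) (F := hF.toLp) (X := hX.toLp)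
    (G := hG.toLp)
    (fun j => by rw [hWc, freq_zero, iCross_zero_left])
    (fun k j => by rw [hWc, realDot_iCross])
    (fun k hk j => by
      rw [co_mulOp_add_cst]; exact iCross_fcoef_of_isCurlCellSol hμ hA hAt hN hk j)
    (fun j => by rw [co_toLp, fcoef_twistedGrad_zero hμ _ (hΨ j).1])
    (fun k j => by rw [co_toLp, fcoef_twistedGrad hμ _ (hΨ j).1, iCross_iVec])
    (fun k hk j => by
      rw [co_mulOp_add_cst]; exact realDot_fcoef_of_isGradCellSol hμ hA (hΨ j) hk)
    (fun k => by rw [co_toLp]; exact realDot_fcoef_of_isQuasiDivFree hG hGdiv k)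
    (fun k => by rw [co_toLp, co_toLp]; exact hD.fcoef_curl hμ hA k)
    (fun k => by
      rw [mulOp_toLp, mulOp_toLp, co_toLp, co_toLp, co_toLp]; exact hD.fcoef_eq hA hAt hε hG k)
    hd
  rw [← hs] at main
  rw [Lp.norm_toLp] at main
  refine le_trans (le_of_eq ?_) (ENNReal.ofReal_le_ofReal main)
  rw [ofReal_norm, Lp.enorm_def]
  refine eLpNorm_congr_ae ?_
  have hcst : cst U s =ᵐ[onCell μ] fun _ => s := by
    rw [cst_eq]; exact MemLp.coeFn_toLp _
  filter_upwards [Lp.coeFn_sub hX.toLp (comb (fun j => (hW j).toLp) s + cst U s),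
    Lp.coeFn_add (comb (fun j => (hW j).toLp) s) (cst U s), toLp_comb hW s, hcst,
    hX.coeFn_toLp] with x a1 a2 a3 a4 a5
  rw [a1, Pi.sub_apply, a2, Pi.add_apply, a3, a4, a5, curlPlusId]

end Problems

end

end PeriodicMaxwell


/-! ### The theorem for the induction and the magnetic field -/

open PeriodicMaxwell in
theorem mainTheorem7 (μ : Measure R3) (hμ : IsAdmissibleMeasure μ)
    (A At : R3 → M3) (hA : IsCoefficient A) (hAt : IsCoefficient At) :
    ∃ C : ℝ, 0 < C ∧
      ∀ (ε : ℝ), 0 < ε →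
      ∀ (θ : R3), (∀ j, ε * θ j ∈ Set.Ico (-Real.pi) Real.pi) →
      -- the cell functions `Ñ`, `N`, `Ψ_κ`
      ∀ (Ntilde Wtilde : Fin 3 → R3 → C3), IsCurlCellSol μ A At Ntilde Wtilde →
      ∀ (N W : Fin 3 → R3 → C3), IsCorrector μ A Ntilde N W →
      ∀ (Ψ : Fin 3 → R3 → ℂ) (g : Fin 3 → R3 → C3), IsPsi μ A (ε • θ) Ψ g →
      -- the data and the solution
      ∀ (G : R3 → C3), MemLp G 2 (onCell μ) → IsQuasiDivFree μ (ε • θ) G →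
      ∀ (D V : R3 → C3), IsMaxwellSol μ A At ε θ G D V →
      ∀ (B H : R3 → C3), B = magInduction ε θ V → H = (fun x => act (At x) (B x)) →
      ∀ d : C3, d = dVec (hatAHom μ A (ε • θ) Ψ g) (tildeAHom μ At Wtilde) θ
          (∫ x, G x ∂(onCell μ)) →
        eLpNorm (fun x => B x + curlPlusId W (iCross θ d) x) 2 (onCell μ) ≤
            ENNReal.ofReal (C * ε) * eLpNorm G 2 (onCell μ) ∧
        eLpNorm (fun x => H x + act (At x) (curlPlusId W (iCross θ d) x)) 2 (onCell μ) ≤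
            ENNReal.ofReal (C * ε) * eLpNorm G 2 (onCell μ) := by
  have hprob := hμ.isProbabilityMeasure
  obtain ⟨α, β, hα, hαβ, hb⟩ := hA.exists_matBounds
  obtain ⟨α', β', hα', hαβ', hb'⟩ := hAt.exists_matBounds
  have hβ : 0 < β := hα.trans_le hαβ
  have hβ' : 0 < β' := hα'.trans_le hαβ'
  have fA : IsEllipticField α β A := ⟨hA.measurable, hα, hb⟩
  have fAt : IsEllipticField α' β' At := ⟨hAt.measurable, hα', hb'⟩
  -- One pair of constants must serve both `A⁻¹`, coercive with `α / β²` and bounded by `α⁻¹`, and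
  -- `Ã`, coercive with `α'` and bounded by `β'`.
  set c := min (α / β ^ 2) α' with hc
  set M := max α⁻¹ β' with hM
  have hc0 : 0 < c := lt_min (by positivity) hα'
  have hM0 : 0 < M := hβ'.trans_le (le_max_right _ _)
  have hS : IsElliptic c M (mulOp μ fA.inv) := isElliptic_mulOp fA.inv
    (fun x v => le_trans (by gcongr; exact min_le_left _ _) ((hb x).inv_lower hα hβ v))
    (le_max_left _ _)
  have hT : IsElliptic c M (mulOp μ (fAt.self hβ'.le)) := isElliptic_mulOp (fAt.self hβ'.le)
    (fun x v => le_trans (by gcongr; exact min_le_right _ _) ((hb' x).lower v))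
    (le_max_right _ _)
  have hC0 : 0 < coreConst c M := by unfold coreConst; positivity
  -- The factor `1 + β'` dominates both `1`, needed for the induction, and `β'`, the cost of
  -- multiplying by `Ã`.
  refine ⟨coreConst c M * (1 + β'), by positivity, ?_⟩
  intro ε hε θ hθ Ntilde Wtilde hN N W hW Ψ g hΨ G hG hGdiv D V hD B H hB hH d hd
  have main := eLpNorm_induction_le hμ fA (fAt.self hβ'.le) hc0 hM0.le hS hT hε hθ hN hΨ hG hGdiv
    hD hd
  rw [ENNReal.ofReal_mul (by positivity), ENNReal.ofReal_toReal hG.2.ne] at main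
  -- The induction is minus the scaled curl, and `W` may be replaced by the curl of `Ñ`, so the
  -- error is that of the abstract estimate up to sign.
  have hBe : (fun x => B x + curlPlusId W (iCross θ d) x) =ᵐ[onCell μ]
      -fun x => scaledCurl ε (ε • θ) V x - curlPlusId Wtilde (iCross θ d) x := by
    filter_upwards [hW.curl_ae_eq hμ fA hN 0, hW.curl_ae_eq hμ fA hN 1,
      hW.curl_ae_eq hμ fA hN 2] with x h0 h1 h2
    rw [Pi.neg_apply, hB, magInduction, conj_expo, scaledCurl, curlPlusId, curlPlusId,
      Fin.sum_univ_three, Fin.sum_univ_three, h0, h1, h2]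
    abel
  have hB1 : eLpNorm (fun x => B x + curlPlusId W (iCross θ d) x) 2 (onCell μ) ≤
      ENNReal.ofReal (coreConst c M * ε) * eLpNorm G 2 (onCell μ) := by
    rw [eLpNorm_congr_ae hBe, eLpNorm_neg]
    exact main
  constructor
  · refine hB1.trans ?_
    gcongr ENNReal.ofReal ?_ * _
    nlinarith [mul_pos hC0 hε, mul_pos (mul_pos hC0 hβ') hε]
  · have hHe : ∀ x, H x + act (At x) (curlPlusId W (iCross θ d) x) =
        act (At x) (B x + curlPlusId W (iCross θ d) x) := fun x => by rw [hH, act_add]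
    simp only [hHe]
    refine (eLpNorm_le_mul_eLpNorm_of_ae_le_mul (c := β')
      (Filter.Eventually.of_forall fun x => (fAt.self hβ'.le).bound x _) 2).trans ?_
    refine (mul_le_mul_right hB1 _).trans ?_
    rw [← mul_assoc, ← ENNReal.ofReal_mul hβ'.le]
    gcongr ENNReal.ofReal ?_ * _
    nlinarith [mul_pos hC0 hε, mul_pos (mul_pos hC0 hβ') hε]
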